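/- Let $\mathcal D$ be the set of Dirichlet series $f(s)=\sum_{n\ge1}a_nn^{-s}$ that converge on some half plane $\mathbb C_\theta=\{s\in\mathbb C:\operatorname{Re}s>\theta\}$, $\theta\in\mathbb R$, let $\mathcal P$ be the set of Dirichlet polynomials, and write $f_\sigma(s)=f(s+\sigma)=\sum_{n\ge1} a_nn^{-\sigma}n^{-s}$. For $0<p<\infty$ let $\mathcal H^p$ be the completion of $\mathcal P$ with respect to the (quasi-)norm $$\|P\|_{\mathcal H^p}=\Big(\int_{\mathbb T^\infty}|\mathcal BP|^p\,dm_\infty\Big)^{1/p},$$ where $m_\infty$ is the normalized Haar measure of the infinite torus $\mathbb T^\infty$ and $\mathcal B\big(\sum_n a_nn^{-s}\big)=\sum_n a_n\prod_jz_j^{\nu_j(n)}$ for $n=\prod_jp_j^{\nu_j(n)}$, with $p_j$ the $j$-th prime. For $0<p,q<\infty$ and $\alpha>-1$ let $\mathcal H^{p,q}_\alpha$ be the completion of $\mathcal P$ with respect to the (quasi-)norm $$\|P\|_{\mathcal H^{p,q}_\alpha}=\Big(\int_0^\infty\|P_\sigma\|_{\mathcal H^p}^q\,d\mu_\alpha(\sigma)\Big)^{1/q},\qquad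 d\mu_\alpha(\sigma)=\frac{2^{\alpha+1}}{\Gamma(\alpha+1)}\sigma^\alpha e^{-2\sigma}\,d\sigma .$$ An element $F$ of one of these completions is said to be the Dirichlet series $f=\sum_n a_nn^{-s}$ if, for every $s$ with $\operatorname{Re}s>1/2$, the series converges at $s$ and $P(s)\to f(s)$ as $P\in\mathcal P$ tends to $F$ in the completion. A Dirichlet series belongs to the space if some element of the space is this series, and its norm is then the norm of that element. Let $0<p,q<\infty$ and $\alpha>-1$. (1) Every $F\in\mathcal H^{p,q}_\alpha$ is a Dirichlet series $f$; the coefficients of $f$ are uniquely determined by $F$, and $F$ is the only element of $\mathcal H^{p,q}_\alpha$ that is the series $f$. The series $f$ converges uniformly on $\mathbb C_{\frac12+\varepsilon}$ for every $\varepsilon>0$, $f_\sigma\in\mathcal H^p$ for every $\sigma>0$, and $$\|f\|_{\mathcal H^{p,q}_\alpha}=\Big(\int_0^\infty\|f_\sigma\|_{\mathcal H^p}^q\,d\mu_\alpha(\sigma)\Big)^{1/q}.$$ (2) Conversely, if $f\in\mathcal D$ satisfies $f_\sigma\in\mathcal H^p$ for all $\sigma>0$ and $\int_0^\infty\|f_\sigma\|_{\mathcal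 H^p}^q\,d\mu_\alpha(\sigma)<\infty$, then $f\in\mathcal H^{p,q}_\alpha$. -/

import Mathlib

open MeasureTheory Filter Topology
open scoped ENNReal NNReal

noncomputable section

namespace DirichletHardy

/-! ### Dirichlet series and Dirichlet polynomials, given by their coefficients -/

/-- The `N`-th partial sum `∑_{n ≤ N} a_n n^{-s}` of the Dirichlet series with coefficients `a`. -/
def partialSum (a : ℕ+ → ℂ) (N : ℕ) (s : ℂ) : ℂ :=
  ∑ i ∈ Finset.range N, a i.succPNat * ((i.succPNat : ℕ) : ℂ) ^ (-s)

/-- The open half plane `ℂ_θ = {s : Re s > θ}`. -/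
def halfPlane (θ : ℝ) : Set ℂ := {s | θ < s.re}

/-- The class `𝒟`: the series `∑ a_n n^{-s}` converges on some half plane. -/
def InD (a : ℕ+ → ℂ) : Prop :=
  ∃ θ : ℝ, ∀ s ∈ halfPlane θ, ∃ v : ℂ, Tendsto (fun N => partialSum a N s) atTop (𝓝 v)

/-- Coefficients of the horizontal translate `f_σ(s) = f(s + σ) = ∑ (a_n n^{-σ}) n^{-s}`. -/
def translate (σ : ℝ) (a : ℕ+ → ℂ) : ℕ+ → ℂ :=
  fun n => a n * ((n : ℕ) : ℂ) ^ (-(σ : ℂ))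

theorem partialSum_translate (σ : ℝ) (a : ℕ+ → ℂ) (N : ℕ) (s : ℂ) :
    partialSum (translate σ a) N s = partialSum a N (s + σ) := by
  refine Finset.sum_congr rfl fun i _ => ?_
  have h : ((i.succPNat : ℕ) : ℂ) ≠ 0 := by exact_mod_cast i.succPNat.ne_zero
  rw [translate, neg_add, Complex.cpow_add _ _ h]
  ring

/-- Dirichlet polynomials `∑ a_n n^{-s}` (finitely many nonzero coefficients). -/
abbrev DirPoly : Type := ℕ+ →₀ ℂ

/-- The value `P(s)` of a Dirichlet polynomial. -/
def polyEval (P : DirPoly) (s : ℂ) : ℂ := P.sum fun n a => a * ((n : ℕ) : ℂ) ^ (-s)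

/-- The translate `P_σ` of a Dirichlet polynomial. -/
def translatePoly (σ : ℝ) (P : DirPoly) : DirPoly :=
  Finsupp.onFinset P.support (translate σ P) fun n h => by
    rw [Finsupp.mem_support_iff]
    rintro h0
    exact h (by simp [translate, h0])

/-! ### The infinite torus and the Bohr lift -/

/-- The countably infinite torus, one coordinate for each prime; a coordinate `x ∈ ℝ/ℤ` stands for
the point `e^{2π i x}` of the unit circle. -/
abbrev InfTorus : Type := Nat.Primes → UnitAddCircle

/-- The normalized Haar measure of the infinite torus: the product of the normalized
Lebesgue measures. -/
def torusMeasure : Measure InfTorus :=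
  Measure.infinitePi fun _ : Nat.Primes => (AddCircle.haarAddCircle : Measure UnitAddCircle)

/-- The monomial `z^{ν(n)} = ∏_p z_p^{ν_p(n)}`, as a product over the multiset of the
prime factors of `n`. -/
def monomial (n : ℕ+) (x : InfTorus) : ℂ :=
  (Multiset.map (fun p : Nat.Primes => ((AddCircle.toCircle (x p) : Circle) : ℂ))
    (PNat.factorMultiset n : Multiset Nat.Primes)).prod

/-- The Bohr lift `∑ a_n z^{ν(n)}` of a Dirichlet polynomial, on the torus. -/
def bohrLift (P : DirPoly) (x : InfTorus) : ℂ := P.sum fun n a => a * monomial n x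

/-! ### The (quasi-)norms on Dirichlet polynomials -/

/-- `‖P‖_{ℋ^p} = (∫ |ℬP|^p dm_∞)^{1/p}`. -/
def hardyPolyNorm (p : ℝ) (P : DirPoly) : ℝ≥0∞ :=
  (∫⁻ x, ‖bohrLift P x‖ₑ ^ p ∂torusMeasure) ^ (1 / p)

/-- The measure `dμ_α(σ) = 2^{α+1} / Γ(α+1) * σ^α * e^{-2σ} dσ` on `(0, ∞)`. -/
def muAlpha (α : ℝ) : Measure ℝ :=
  (volume.restrict (Set.Ioi (0 : ℝ))).withDensity fun σ =>
    ENNReal.ofReal (2 ^ (α + 1) / Real.Gamma (α + 1) * σ ^ α * Real.exp (-2 * σ))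

/-- `‖P‖_{ℋ^{p,q}_α} = (∫ ‖P_σ‖_{ℋ^p}^q dμ_α(σ))^{1/q}`. -/
def mixedPolyNorm (p q α : ℝ) (P : DirPoly) : ℝ≥0∞ :=
  (∫⁻ σ, hardyPolyNorm p (translatePoly σ P) ^ q ∂(muAlpha α)) ^ (1 / q)

/-! ### Proved facts: the `min 1 p`-th power of the Hardy norm and the `min (min 1 p) q`-th power
of the mixed norm are finite and subadditive -/

theorem bohrLift_add (P Q : DirPoly) (x : InfTorus) :
    bohrLift (P + Q) x = bohrLift P x + bohrLift Q x :=
  Finsupp.sum_add_index' (by simp) (by intros; ring)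

theorem bohrLift_neg (P : DirPoly) (x : InfTorus) : bohrLift (-P) x = -bohrLift P x := by
  have h := bohrLift_add P (-P) x
  rw [add_neg_cancel] at h
  have h0 : bohrLift 0 x = 0 := Finsupp.sum_zero_index
  rw [h0] at h
  exact (neg_eq_of_add_eq_zero_right h.symm).symm

theorem measurable_monomial (n : ℕ+) : Measurable (monomial n) := by
  refine Continuous.measurable (continuous_multiset_prod _ fun p _ => ?_)
  exact continuous_subtype_val.comp (AddCircle.continuous_toCircle.comp (continuous_apply p))

theorem norm_monomial (n : ℕ+) (x : InfTorus) : ‖monomial n x‖ = 1 := by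
  have h : ∀ m : Multiset Nat.Primes, ‖(Multiset.map
      (fun p : Nat.Primes => ((AddCircle.toCircle (x p) : Circle) : ℂ)) m).prod‖ = 1 := by
    intro m
    induction m using Multiset.induction_on with
    | empty => simp
    | cons p m ih =>
      simp only [Multiset.map_cons, Multiset.prod_cons, norm_mul, ih, Circle.norm_coe, mul_one]
  exact h _

theorem translatePoly_add (σ : ℝ) (P Q : DirPoly) :
    translatePoly σ (P + Q) = translatePoly σ P + translatePoly σ Q := by
  ext n; simp [translatePoly, translate, add_mul]

theorem translatePoly_neg (σ : ℝ) (P : DirPoly) :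
    translatePoly σ (-P) = -translatePoly σ P := by
  ext n; simp [translatePoly, translate]

theorem bohrLift_translatePoly (σ : ℝ) (P : DirPoly) (x : InfTorus) :
    bohrLift (translatePoly σ P) x =
      ∑ n ∈ P.support, P n * ((n : ℕ) : ℂ) ^ (-(σ : ℂ)) * monomial n x :=
  Finsupp.onFinset_sum _ (by simp)

theorem measurable_bohrLift (P : DirPoly) : Measurable (bohrLift P) :=
  Finset.measurable_fun_sum _ fun n _ => (measurable_monomial n).const_mul _

theorem measurable_hardyPolyNorm_translatePoly (p : ℝ) (P : DirPoly) :
    Measurable fun σ : ℝ => hardyPolyNorm p (translatePoly σ P) := by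
  have : SFinite torusMeasure := by unfold torusMeasure; infer_instance
  refine Measurable.pow_const (Measurable.lintegral_prod_right'
    (f := fun y : ℝ × InfTorus => ‖bohrLift (translatePoly y.1 P) y.2‖ₑ ^ p) ?_) _
  refine Measurable.pow_const (Measurable.enorm ?_) _
  simp only [bohrLift_translatePoly]
  refine Finset.measurable_fun_sum _ fun n _ => ?_
  refine Measurable.mul (Measurable.const_mul ?_ _) ((measurable_monomial n).comp measurable_snd)
  have h : Continuous fun σ : ℝ => ((n : ℕ) : ℂ) ^ (-(σ : ℂ)) :=
    Continuous.const_cpow (by fun_prop) (Or.inl (by exact_mod_cast n.ne_zero))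
  exact h.measurable.comp measurable_fst

theorem isProbabilityMeasure_torusMeasure : IsProbabilityMeasure torusMeasure := by
  unfold torusMeasure; infer_instance

theorem muAlpha_univ_ne_top {α : ℝ} (hα : -1 < α) : muAlpha α Set.univ ≠ ∞ := by
  have h : IntegrableOn (fun σ : ℝ => σ ^ α * Real.exp (-2 * σ ^ (1 : ℝ))) (Set.Ioi 0) :=
    integrableOn_rpow_mul_exp_neg_mul_rpow hα one_pos two_pos
  have h2 := (h.const_mul (2 ^ (α + 1) / Real.Gamma (α + 1))).lintegral_lt_top
  rw [muAlpha, withDensity_apply _ MeasurableSet.univ, Measure.restrict_univ]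
  simpa [Real.rpow_one, mul_assoc] using h2.ne

theorem hardyPolyNorm_le {p : ℝ} (hp : 0 < p) (P : DirPoly) :
    hardyPolyNorm p P ≤ ∑ n ∈ P.support, ‖P n‖ₑ := by
  have := isProbabilityMeasure_torusMeasure
  have h : ∀ x, ‖bohrLift P x‖ₑ ≤ ∑ n ∈ P.support, ‖P n‖ₑ := fun x => by
    refine (enorm_sum_le _ _).trans (Finset.sum_le_sum fun n _ => ?_)
    have h1 : ‖monomial n x‖ₑ = 1 := by rw [← ofReal_norm, norm_monomial]; simp
    rw [enorm_mul, h1, mul_one]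
  calc hardyPolyNorm p P
      ≤ (∫⁻ _, (∑ n ∈ P.support, ‖P n‖ₑ) ^ p ∂torusMeasure) ^ (1 / p) := by
        unfold hardyPolyNorm
        gcongr with x
        exact h x
    _ = _ := by
        rw [lintegral_const, measure_univ, mul_one, ← ENNReal.rpow_mul,
          mul_one_div_cancel hp.ne', ENNReal.rpow_one]

theorem hardyPolyNorm_ne_top {p : ℝ} (hp : 0 < p) (P : DirPoly) : hardyPolyNorm p P ≠ ∞ :=
  ((hardyPolyNorm_le hp P).trans_lt (ENNReal.sum_lt_top.2 fun _ _ => enorm_lt_top)).ne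

theorem hardyPolyNorm_translatePoly_le {p : ℝ} (hp : 0 < p) (P : DirPoly) {σ : ℝ} (hσ : 0 < σ) :
    hardyPolyNorm p (translatePoly σ P) ≤ ∑ n ∈ P.support, ‖P n‖ₑ := by
  refine (hardyPolyNorm_le hp _).trans ?_
  have hs : (translatePoly σ P).support ⊆ P.support := Finsupp.support_onFinset_subset
  refine (Finset.sum_le_sum_of_subset hs).trans (Finset.sum_le_sum fun n _ => ?_)
  have h1 : ‖((n : ℕ) : ℂ) ^ (-(σ : ℂ))‖ ≤ 1 := by
    rw [Complex.norm_natCast_cpow_of_pos n.pos]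
    refine Real.rpow_le_one_of_one_le_of_nonpos (by exact_mod_cast n.pos) ?_
    simpa using hσ.le
  rw [← ofReal_norm, ← ofReal_norm]
  refine ENNReal.ofReal_le_ofReal ?_
  change ‖P n * ((n : ℕ) : ℂ) ^ (-(σ : ℂ))‖ ≤ ‖P n‖
  rw [norm_mul]
  exact mul_le_of_le_one_right (norm_nonneg _) h1

theorem mixedPolyNorm_ne_top {p q α : ℝ} (hp : 0 < p) (hq : 0 < q) (hα : -1 < α) (P : DirPoly) :
    mixedPolyNorm p q α P ≠ ∞ := by
  have hC : (∑ n ∈ P.support, ‖P n‖ₑ) ≠ ∞ :=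
    (ENNReal.sum_lt_top.2 fun _ _ => enorm_lt_top).ne
  refine ENNReal.rpow_ne_top_of_nonneg (by positivity) ?_
  have hae : ∀ᵐ σ ∂(muAlpha α), 0 < σ :=
    (withDensity_absolutelyContinuous _ _).ae_le (ae_restrict_mem measurableSet_Ioi)
  have hle : (∫⁻ σ, hardyPolyNorm p (translatePoly σ P) ^ q ∂(muAlpha α)) ≤
      ∫⁻ _, (∑ n ∈ P.support, ‖P n‖ₑ) ^ q ∂(muAlpha α) := by
    refine lintegral_mono_ae ?_
    filter_upwards [hae] with σ hσ
    exact ENNReal.rpow_le_rpow (hardyPolyNorm_translatePoly_le hp P hσ) hq.le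
  refine (hle.trans_lt ?_).ne
  rw [lintegral_const]
  exact ENNReal.mul_lt_top (ENNReal.rpow_lt_top_of_nonneg hq.le hC)
    (muAlpha_univ_ne_top hα).lt_top

/-- If `w^t ≤ u^t + v^t` pointwise, the `min t q`-th power of the `L^q` (quasi-)norm is
subadditive along `u, v, w`. -/
theorem Lq_rpow_min_le {X : Type*} [MeasurableSpace X] (μ : Measure X) {t q : ℝ} (ht : 0 < t)
    (hq : 0 < q) {u v w : X → ℝ≥0∞} (hu : Measurable u) (hv : Measurable v)
    (h : ∀ x, w x ^ t ≤ u x ^ t + v x ^ t) :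
    ((∫⁻ x, w x ^ q ∂μ) ^ (1 / q)) ^ min t q ≤
      ((∫⁻ x, u x ^ q ∂μ) ^ (1 / q)) ^ min t q + ((∫⁻ x, v x ^ q ∂μ) ^ (1 / q)) ^ min t q := by
  have e : ∀ a : ℝ≥0∞, (a ^ t) ^ (q / t) = a ^ q := fun a => by
    rw [← ENNReal.rpow_mul, mul_div_cancel₀ _ ht.ne']
  rcases le_total t q with htq | hqt
  · rw [min_eq_left htq]
    have e' : ∀ a : ℝ≥0∞, (a ^ (1 / q)) ^ t = a ^ (1 / (q / t)) := fun a => by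
      rw [← ENNReal.rpow_mul]; congr 1; field_simp
    have hM := ENNReal.lintegral_Lp_add_le (μ := μ) (p := q / t) (f := fun x => u x ^ t)
      (g := fun x => v x ^ t) (hu.pow_const _).aemeasurable (hv.pow_const _).aemeasurable
      ((one_le_div ht).2 htq)
    simp only [e, Pi.add_apply] at hM
    simp only [e']
    refine le_trans ?_ hM
    refine ENNReal.rpow_le_rpow (lintegral_mono fun x => ?_) (by positivity)
    rw [← e (w x)]
    exact ENNReal.rpow_le_rpow (h x) (by positivity)
  · rw [min_eq_right hqt]
    simp only [← ENNReal.rpow_mul, one_div, inv_mul_cancel₀ hq.ne', ENNReal.rpow_one]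
    rw [← lintegral_add_left (hu.pow_const _)]
    refine lintegral_mono fun x => ?_
    calc w x ^ q = (w x ^ t) ^ (q / t) := (e _).symm
      _ ≤ (u x ^ t + v x ^ t) ^ (q / t) := ENNReal.rpow_le_rpow (h x) (by positivity)
      _ ≤ (u x ^ t) ^ (q / t) + (v x ^ t) ^ (q / t) :=
        ENNReal.rpow_add_le_add_rpow _ _ (by positivity) ((div_le_one ht).2 hqt)
      _ = u x ^ q + v x ^ q := by rw [e, e]

theorem hardyPolyNorm_add {p : ℝ} (hp : 0 < p) (P Q : DirPoly) :
    hardyPolyNorm p (P + Q) ^ min 1 p ≤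
      hardyPolyNorm p P ^ min 1 p + hardyPolyNorm p Q ^ min 1 p := by
  refine Lq_rpow_min_le torusMeasure one_pos hp (measurable_bohrLift P).enorm
    (measurable_bohrLift Q).enorm fun x => ?_
  simp only [ENNReal.rpow_one, bohrLift_add]
  exact enorm_add_le _ _

theorem mixedPolyNorm_add {p q α : ℝ} (hp : 0 < p) (hq : 0 < q) (P Q : DirPoly) :
    mixedPolyNorm p q α (P + Q) ^ min (min 1 p) q ≤
      mixedPolyNorm p q α P ^ min (min 1 p) q + mixedPolyNorm p q α Q ^ min (min 1 p) q := by
  refine Lq_rpow_min_le (muAlpha α) (lt_min one_pos hp) hq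
    (measurable_hardyPolyNorm_translatePoly p P) (measurable_hardyPolyNorm_translatePoly p Q)
    fun σ => ?_
  rw [translatePoly_add]
  exact hardyPolyNorm_add hp _ _

theorem hardyPolyNorm_zero {p : ℝ} (hp : 0 < p) : hardyPolyNorm p 0 = 0 := by
  simpa using hardyPolyNorm_le hp 0

theorem hardyPolyNorm_neg (p : ℝ) (P : DirPoly) : hardyPolyNorm p (-P) = hardyPolyNorm p P := by
  simp [hardyPolyNorm, bohrLift_neg]

theorem mixedPolyNorm_zero {p q : ℝ} (α : ℝ) (hp : 0 < p) (hq : 0 < q) :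
    mixedPolyNorm p q α 0 = 0 := by
  have h : ∀ σ, translatePoly σ 0 = 0 := fun σ => by ext n; simp [translatePoly, translate]
  simp [mixedPolyNorm, h, hardyPolyNorm_zero hp, hq]

theorem mixedPolyNorm_neg (p q α : ℝ) (P : DirPoly) :
    mixedPolyNorm p q α (-P) = mixedPolyNorm p q α P := by
  simp [mixedPolyNorm, translatePoly_neg, hardyPolyNorm_neg]

/-- The `r`-th power of a finite (quasi-)norm whose `r`-th power is subadditive, as an additive
group seminorm. Its metric `d(P, Q) = ‖P - Q‖^r` induces the uniform structure of the
(quasi-)norm. -/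
def rpowSeminorm (N : DirPoly → ℝ≥0∞) (r : ℝ) (hr : 0 < r) (hfin : ∀ P, N P ≠ ∞) (h0 : N 0 = 0)
    (hneg : ∀ P, N (-P) = N P) (hadd : ∀ P Q, N (P + Q) ^ r ≤ N P ^ r + N Q ^ r) :
    AddGroupSeminorm DirPoly where
  toFun P := (N P).toReal ^ r
  map_zero' := by simp [h0, hr.ne']
  neg' P := by rw [hneg]
  add_le' P Q := by
    have hf : ∀ P, N P ^ r ≠ ∞ := fun P => ENNReal.rpow_ne_top_of_nonneg hr.le (hfin P)
    simp only [ENNReal.toReal_rpow]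
    rw [← ENNReal.toReal_add (hf P) (hf Q)]
    exact ENNReal.toReal_mono (ENNReal.add_ne_top.2 ⟨hf P, hf Q⟩) (hadd P Q)

/-! ### The spaces `ℋ^p` and `ℋ^{p,q}_α`: completions of the Dirichlet polynomials -/

/-- Dirichlet polynomials, metrized by `d(P, Q) = ‖P - Q‖_{ℋ^p}^r`, `r = min 1 p`. -/
def HardyPoly (p : ℝ) (_hp : 0 < p) : Type := DirPoly

instance instHardyPoly (p : ℝ) (hp : 0 < p) : SeminormedAddCommGroup (HardyPoly p hp) :=
  @AddGroupSeminorm.toSeminormedAddCommGroup DirPoly _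
    (rpowSeminorm (hardyPolyNorm p) (min 1 p) (lt_min one_pos hp) (hardyPolyNorm_ne_top hp)
      (hardyPolyNorm_zero hp) (hardyPolyNorm_neg p) (hardyPolyNorm_add hp))

/-- Dirichlet polynomials, metrized by `d(P, Q) = ‖P - Q‖_{ℋ^{p,q}_α}^r`,
`r = min (min 1 p) q`. -/
def MixedPoly (p q α : ℝ) (_hp : 0 < p) (_hq : 0 < q) (_hα : -1 < α) : Type := DirPoly

instance instMixedPoly (p q α : ℝ) (hp : 0 < p) (hq : 0 < q) (hα : -1 < α) :
    SeminormedAddCommGroup (MixedPoly p q α hp hq hα) :=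
  @AddGroupSeminorm.toSeminormedAddCommGroup DirPoly _
    (rpowSeminorm (mixedPolyNorm p q α) (min (min 1 p) q) (lt_min (lt_min one_pos hp) hq)
      (mixedPolyNorm_ne_top hp hq hα) (mixedPolyNorm_zero α hp hq) (mixedPolyNorm_neg p q α)
      (mixedPolyNorm_add hp hq))

/-- The Hardy space `ℋ^p`: the completion of the Dirichlet polynomials. -/
abbrev HardySpace (p : ℝ) (hp : 0 < p) : Type := UniformSpace.Completion (HardyPoly p hp)

/-- The mixed norm space `ℋ^{p,q}_α`: the completion of the Dirichlet polynomials. -/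
abbrev MixedSpace (p q α : ℝ) (hp : 0 < p) (hq : 0 < q) (hα : -1 < α) : Type :=
  UniformSpace.Completion (MixedPoly p q α hp hq hα)

/-- A Dirichlet polynomial as an element of `ℋ^p`. -/
def toHardy (p : ℝ) (hp : 0 < p) (P : DirPoly) : HardySpace p hp :=
  ((show HardyPoly p hp from P : HardyPoly p hp) : UniformSpace.Completion (HardyPoly p hp))

/-- A Dirichlet polynomial as an element of `ℋ^{p,q}_α`. -/
def toMixed (p q α : ℝ) (hp : 0 < p) (hq : 0 < q) (hα : -1 < α) (P : DirPoly) :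
    MixedSpace p q α hp hq hα :=
  ((show MixedPoly p q α hp hq hα from P : MixedPoly p q α hp hq hα) :
    UniformSpace.Completion (MixedPoly p q α hp hq hα))

/-- The (quasi-)norm of `ℋ^p`: the continuous extension of the one of the Dirichlet polynomials
(the norm of the completion extends its `r`-th power). -/
def hardyNorm {p : ℝ} {hp : 0 < p} (F : HardySpace p hp) : ℝ := ‖F‖ ^ (1 / min 1 p)

/-- The (quasi-)norm of `ℋ^{p,q}_α`: the continuous extension of the one of the
Dirichlet polynomials. -/
def mixedNorm {p q α : ℝ} {hp : 0 < p} {hq : 0 < q} {hα : -1 < α}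
    (F : MixedSpace p q α hp hq hα) : ℝ := ‖F‖ ^ (1 / min (min 1 p) q)

theorem hardyNorm_toHardy (p : ℝ) (hp : 0 < p) (P : DirPoly) :
    hardyNorm (toHardy p hp P) = (hardyPolyNorm p P).toReal := by
  have hr : min 1 p ≠ 0 := (lt_min one_pos hp).ne'
  have h : ‖toHardy p hp P‖ = (hardyPolyNorm p P).toReal ^ min 1 p :=
    UniformSpace.Completion.norm_coe (E := HardyPoly p hp) P
  rw [hardyNorm, h, ← Real.rpow_mul ENNReal.toReal_nonneg, mul_one_div_cancel hr, Real.rpow_one]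

theorem mixedNorm_toMixed (p q α : ℝ) (hp : 0 < p) (hq : 0 < q) (hα : -1 < α) (P : DirPoly) :
    mixedNorm (toMixed p q α hp hq hα P) = (mixedPolyNorm p q α P).toReal := by
  have hr : min (min 1 p) q ≠ 0 := (lt_min (lt_min one_pos hp) hq).ne'
  have h : ‖toMixed p q α hp hq hα P‖ = (mixedPolyNorm p q α P).toReal ^ min (min 1 p) q :=
    UniformSpace.Completion.norm_coe (E := MixedPoly p q α hp hq hα) P
  rw [mixedNorm, h, ← Real.rpow_mul ENNReal.toReal_nonneg, mul_one_div_cancel hr, Real.rpow_one]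

/-! ### Elements of the completions as Dirichlet series -/

/-- The element `F` of a completion `X` of the Dirichlet polynomials (with canonical map `ι`) is
the Dirichlet series with coefficients `a`: at every `s` with `Re s > 1/2`, point evaluation
of polynomials extends continuously to `F`, the series converges, and its sum is the value
`F(s) = lim P(s)` (`P → F`) so obtained. -/
def IsSeriesOf {X : Type*} [TopologicalSpace X] (ι : DirPoly → X) (F : X) (a : ℕ+ → ℂ) : Prop :=
  ∀ s ∈ halfPlane (1 / 2), ∃ v : ℂ,
    Tendsto (fun P => polyEval P s) (comap ι (𝓝 F)) (𝓝 v) ∧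
    Tendsto (fun N => partialSum a N s) atTop (𝓝 v)

/-- The Dirichlet series with coefficients `a` belongs to `ℋ^p`. -/
def MemHardy (p : ℝ) (hp : 0 < p) (a : ℕ+ → ℂ) : Prop :=
  ∃ G : HardySpace p hp, IsSeriesOf (toHardy p hp) G a

/-- The Dirichlet series with coefficients `a` belongs to `ℋ^{p,q}_α`. -/
def MemMixed (p q α : ℝ) (hp : 0 < p) (hq : 0 < q) (hα : -1 < α) (a : ℕ+ → ℂ) : Prop :=
  ∃ F : MixedSpace p q α hp hq hα, IsSeriesOf (toMixed p q α hp hq hα) F a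

/-- `‖f‖_{ℋ^p}` for a Dirichlet series `f` with coefficients `a`: the (quasi-)norm of the element
of `ℋ^p` that is this series, and `∞` if there is none. -/
def seriesHardyNorm (p : ℝ) (hp : 0 < p) (a : ℕ+ → ℂ) : ℝ≥0∞ :=
  ⨅ (G : HardySpace p hp) (_ : IsSeriesOf (toHardy p hp) G a), ENNReal.ofReal (hardyNorm G)

end DirichletHardy

end

/-! Everything rests on two facts about `ℋ^p` that hold for every `0 < p < ∞`, also below `1`, where
duality is lost. First, the translations `P ↦ P_σ`, `σ ≥ 0`, are contractions
(`hardyPolyNorm_translatePoly_le_self`). Second, Helson's inequality `∑ |a_n|² / d(n)^k ≤ ‖P‖²`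
holds for `2/(k+1) ≤ p`, with `d` the divisor function (`sum_sq_div_divisorCount_le`). Both are
one-variable facts iterated over the primes. A polynomial is `f = B g` with `B` inner and `g` having
holomorphic powers in the disc, so `|f|^p = |g^{p/2}|²` on the circle and Parseval's identity
applies.

Since `d(n) = O(n^ε)`, Helson's inequality and Cauchy–Schwarz bound `∑ |a_n| n^{-σ}` by the norm for
`σ > 1/2`. Hence coefficients and point values extend continuously to the completion.

The coefficients determine the element of `ℋ^p` (`eq_zero_of_hardyCoeff_eq_zero`). If those of `F =
lim R_k` vanish, a translation by `δ > 0` absorbs the weight `d(n)^k`, so `(R_k)_δ → 0` in `L²` and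
almost everywhere along a subsequence. Fatou's lemma and the Cauchy property then give `F_δ = 0`,
and `F_δ → F` as `δ → 0`.

For the mixed space, `‖P_τ‖` decreases in `τ` and `μ_α` charges `(0, σ]`, so `F ↦ F_σ` is continuous
into `ℋ^p` for each `σ > 0`, and the results for `ℋ^p` transfer. In the norm formula
(`lintegral_translateNorm`), `≤` is Fatou's lemma; the reverse follows from subadditivity of a power
of the norm, applied to `P = F + (P - F)`.

For the converse, `f_δ` lies in `ℋ^p`, hence in the mixed space, and `(f_δ)_σ = (f_σ)_δ → f_σ` in
`ℋ^p` with norms at most `‖f_σ‖`. Dominated convergence makes `f_δ` Cauchy along `δ = 1/(k+1)`; the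
limit has the coefficients of `f`. -/

noncomputable section

namespace DirichletHardy

section Disc

open Metric Complex

/-! ### Fourier coefficients of functions holomorphic in the unit disc -/

/-- The boundary values on the unit circle, as a function on `ℝ/ℤ`. -/
def onCircle (G : ℂ → ℂ) (t : UnitAddCircle) : ℂ := G (AddCircle.toCircle t : Circle)

/-- The substitution `θ = 2πx` makes Cauchy's theorem and Cauchy's formula available for Fourier
coefficients. -/
theorem fourierCoeff_onCircle (G : ℂ → ℂ) (n : ℤ) :
    fourierCoeff (onCircle G) n =
      (2 * Real.pi * I)⁻¹ * ∮ z in C(0, 1), z ^ (-n - 1) * G z := by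
  have h1 := intervalIntegral.integral_comp_mul_left (a := 0) (b := 1)
    (fun θ : ℝ => deriv (circleMap 0 1) θ • ((circleMap 0 1 θ) ^ (-n - 1) * G (circleMap 0 1 θ)))
    (c := 2 * Real.pi) (by positivity)
  rw [fourierCoeff_eq_intervalIntegral _ _ 0, circleIntegral, zero_add, div_one, one_smul]
  rw [mul_zero, mul_one] at h1
  have h2 : (∫ θ in (0 : ℝ)..2 * Real.pi,
      deriv (circleMap 0 1) θ • ((circleMap 0 1 θ) ^ (-n - 1) * G (circleMap 0 1 θ))) =
      (2 * Real.pi : ℝ) • ∫ x in (0 : ℝ)..1, deriv (circleMap 0 1) (2 * Real.pi * x) •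
        ((circleMap 0 1 (2 * Real.pi * x)) ^ (-n - 1) * G (circleMap 0 1 (2 * Real.pi * x))) := by
    rw [h1, smul_inv_smul₀ (by positivity)]
  rw [h2, ← intervalIntegral.integral_smul, ← intervalIntegral.integral_const_mul]
  refine intervalIntegral.integral_congr fun x _ => ?_
  have hz : circleMap 0 1 (2 * Real.pi * x) =
      ((AddCircle.toCircle (x : UnitAddCircle) : Circle) : ℂ) := by
    rw [AddCircle.toCircle_apply_mk, Circle.coe_exp]
    simp [circleMap]
  have h0 : circleMap 0 1 (2 * Real.pi * x) ≠ 0 := by rw [hz]; exact Circle.coe_ne_zero _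
  simp only [deriv_circleMap, smul_eq_mul, onCircle, ← hz]
  have hf : fourier (-n) (x : UnitAddCircle) = (circleMap 0 1 (2 * Real.pi * x)) ^ (-n) := by
    rw [hz, fourier_apply, AddCircle.toCircle_zsmul]; simp
  rw [hf, zpow_sub₀ h0, zpow_one, real_smul]
  have hpi : (Real.pi : ℂ) ≠ 0 := by exact_mod_cast Real.pi_ne_zero
  push_cast
  field_simp

theorem fourierCoeff_onCircle_of_neg {G : ℂ → ℂ} (hG : DiffContOnCl ℂ G (ball 0 1)) {n : ℤ}
    (hn : n < 0) : fourierCoeff (onCircle G) n = 0 := by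
  obtain ⟨k, hk⟩ := Int.eq_ofNat_of_zero_le (show 0 ≤ -n - 1 by omega)
  have hd : DiffContOnCl ℂ (fun z : ℂ => z ^ k • G z) (ball 0 1) :=
    (Differentiable.diffContOnCl (by fun_prop)).smul hG
  rw [fourierCoeff_onCircle, hk]
  have := hd.circleIntegral_eq_zero zero_le_one
  simp only [smul_eq_mul] at this
  simp [this]

/-- `F(z) = ∑ a_n z^n` in the unit disc. -/
def HasTaylor (a : ℕ → ℂ) (F : ℂ → ℂ) : Prop :=
  ∀ z ∈ ball (0 : ℂ) 1, HasSum (fun n => a n * z ^ n) (F z)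

/-- Cauchy's integrals for the Taylor coefficients are the Fourier integrals of the boundary values.
-/
theorem hasTaylor_fourierCoeff {G : ℂ → ℂ} (hG : DiffContOnCl ℂ G (ball 0 1)) :
    HasTaylor (fun n => fourierCoeff (onCircle G) n) G := by
  intro z hz
  have hG' : DiffContOnCl ℂ G (ball 0 ((1 : ℝ≥0) : ℝ)) := by simpa using hG
  have h := (hG'.hasFPowerSeriesOnBall one_pos).hasSum (y := z) (by
    simpa [Metric.mem_eball, edist_zero_right, enorm_eq_nnnorm, ← NNReal.coe_lt_coe] using hz)
  rw [zero_add] at h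
  refine h.congr_fun fun n => ?_
  dsimp only
  rw [cauchyPowerSeries_apply, fourierCoeff_onCircle, smul_eq_mul, mul_assoc]
  congr 1
  rw [mul_comm, ← circleIntegral.integral_const_mul]
  refine circleIntegral.integral_congr (by simp) fun w hw => ?_
  have hw0 : w ≠ 0 := by
    rintro rfl
    simp at hw
  simp only [sub_zero, smul_eq_mul]
  rw [zpow_sub₀ hw0, zpow_neg, zpow_natCast, zpow_one]
  rw [div_pow]
  field_simp

theorem HasTaylor.unique {a b : ℕ → ℂ} {F : ℂ → ℂ} (ha : HasTaylor a F) (hb : HasTaylor b F) :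
    a = b := by
  have key : ∀ {c : ℕ → ℂ}, HasTaylor c F →
      HasFPowerSeriesAt F (FormalMultilinearSeries.ofScalars ℂ c) 0 := fun {c} hc => by
    rw [hasFPowerSeriesAt_iff]
    filter_upwards [ball_mem_nhds (0 : ℂ) one_pos] with z hz
    simpa [FormalMultilinearSeries.coeff_ofScalars, mul_comm] using hc z hz
  have h := (key ha).eq_formalMultilinearSeries (key hb)
  funext n
  simpa using congrArg (fun p => FormalMultilinearSeries.coeff p n) h

theorem HasTaylor.mul {a b : ℕ → ℂ} {F G : ℂ → ℂ} (ha : HasTaylor a F) (hb : HasTaylor b G) :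
    HasTaylor (fun n => ∑ k ∈ Finset.HasAntidiagonal.antidiagonal n, a k.1 * b k.2) (fun z => F z * G z) := by
  intro z hz
  have h1 := (ha z hz).summable.norm
  have h2 := (hb z hz).summable.norm
  have h3 := (summable_norm_sum_mul_antidiagonal_of_summable_norm h1 h2).of_norm.hasSum
  rw [← tsum_mul_tsum_eq_tsum_sum_antidiagonal_of_summable_norm h1 h2, (ha z hz).tsum_eq,
    (hb z hz).tsum_eq] at h3
  refine h3.congr_fun fun n => ?_
  rw [Finset.sum_mul]
  refine Finset.sum_congr rfl fun k hk => ?_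
  rw [← Finset.HasAntidiagonal.mem_antidiagonal.1 hk, pow_add]
  ring

theorem hasTaylor_polynomial (f : Polynomial ℂ) : HasTaylor f.coeff (fun z => f.eval z) := by
  intro z _
  dsimp only
  rw [Polynomial.eval_eq_sum_range]
  refine hasSum_sum_of_ne_finset_zero fun n hn => ?_
  rw [f.coeff_eq_zero_of_natDegree_lt (by simpa using hn), zero_mul]

theorem continuous_onCircle {G : ℂ → ℂ} (hG : DiffContOnCl ℂ G (ball 0 1)) :
    Continuous (onCircle G) := by
  have h := hG.continuousOn
  rw [closure_ball _ one_ne_zero] at h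
  exact h.comp_continuous (continuous_subtype_val.comp AddCircle.continuous_toCircle) fun t => by
    simp [Circle.norm_coe]

/-- Parseval's identity for functions in the disc algebra. -/
theorem tsum_sq_taylor {G : ℂ → ℂ} (hG : DiffContOnCl ℂ G (ball 0 1)) {a : ℕ → ℂ}
    (ha : HasTaylor a G) :
    ∑' n, ‖a n‖ₑ ^ 2 = ∫⁻ t, ‖onCircle G t‖ₑ ^ 2 ∂AddCircle.haarAddCircle := by
  obtain rfl := ha.unique (hasTaylor_fourierCoeff hG)
  let f : C(UnitAddCircle, ℂ) := ⟨onCircle G, continuous_onCircle hG⟩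
  have hP := tsum_sq_fourierCoeff (ContinuousMap.toLp 2 AddCircle.haarAddCircle ℂ f)
  have hS := (hasSum_sq_fourierCoeff (ContinuousMap.toLp 2 AddCircle.haarAddCircle ℂ f)).summable
  have h2 : ∫ t, ‖(ContinuousMap.toLp 2 AddCircle.haarAddCircle ℂ f) t‖ ^ 2
      ∂(AddCircle.haarAddCircle : Measure UnitAddCircle) =
      ∫ t, ‖onCircle G t‖ ^ 2 ∂AddCircle.haarAddCircle := by
    refine integral_congr_ae ?_
    filter_upwards [ContinuousMap.coeFn_toLp (𝕜 := ℂ) (p := 2) AddCircle.haarAddCircle f] with t ht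
    rw [ht]; rfl
  simp only [fourierCoeff_toLp] at hP hS
  rw [h2] at hP
  have h3 : ∀ x : ℂ, ‖x‖ₑ ^ 2 = ENNReal.ofReal (‖x‖ ^ 2) := fun x => by
    rw [← ofReal_norm, ENNReal.ofReal_pow (norm_nonneg _)]
  simp only [h3]
  rw [← ofReal_integral_eq_lintegral_ofReal
    (f := fun t => ‖onCircle G t‖ ^ 2)
    (((continuous_onCircle hG).norm.pow 2).integrable_of_hasCompactSupport
      (HasCompactSupport.of_compactSpace _)) (ae_of_all _ fun t => by positivity), ← hP]
  -- Negative frequencies vanish by Cauchy's theorem, so the sum over `ℤ` is a sum over `ℕ`.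
  have h4 : ∑' i : ℤ, ‖fourierCoeff f i‖ ^ 2 = ∑' n : ℕ, ‖fourierCoeff f n‖ ^ 2 := by
    refine ((Nat.cast_injective (R := ℤ)).tsum_eq fun i hi => ?_).symm
    by_contra hn
    refine hi ?_
    have : i < 0 := by
      by_contra h0
      exact hn ⟨i.toNat, by simpa using h0⟩
    simp only [f, ContinuousMap.coe_mk, fourierCoeff_onCircle_of_neg hG this]
    simp
  rw [h4, ENNReal.ofReal_tsum_of_nonneg (f := fun n : ℕ => ‖fourierCoeff f n‖ ^ 2)
    (fun _ => by positivity) (hS.comp_injective Nat.cast_injective)]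
  rfl

/-! ### Inner-outer factorization of polynomials -/

/-- `f = B * g` on the closed unit disc, `B` being inner and `g` having the powers `G s = g^s`. -/
structure InnerOuter (f B : ℂ → ℂ) (G : ℝ → ℂ → ℂ) : Prop where
  inner : DiffContOnCl ℂ B (ball 0 1)
  norm_le : ∀ z ∈ closedBall (0 : ℂ) 1, ‖B z‖ ≤ 1
  norm_eq : ∀ z ∈ sphere (0 : ℂ) 1, ‖B z‖ = 1
  outer : ∀ s, 0 < s → DiffContOnCl ℂ (G s) (ball 0 1)
  norm_outer : ∀ s z, ‖G s z‖ = ‖G 1 z‖ ^ s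
  root : ∀ m : ℕ, m ≠ 0 → ∀ z, G (m : ℝ)⁻¹ z ^ m = G 1 z
  eq : ∀ z ∈ closedBall (0 : ℂ) 1, f z = B z * G 1 z

theorem InnerOuter.mul {f₁ f₂ B₁ B₂ : ℂ → ℂ} {G₁ G₂ : ℝ → ℂ → ℂ} (h₁ : InnerOuter f₁ B₁ G₁)
    (h₂ : InnerOuter f₂ B₂ G₂) :
    InnerOuter (fun z => f₁ z * f₂ z) (fun z => B₁ z * B₂ z) (fun s z => G₁ s z * G₂ s z) where
  inner := h₁.inner.smul h₂.inner
  norm_le z hz := by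
    rw [norm_mul]
    exact mul_le_one₀ (h₁.norm_le z hz) (norm_nonneg _) (h₂.norm_le z hz)
  norm_eq z hz := by rw [norm_mul, h₁.norm_eq z hz, h₂.norm_eq z hz, one_mul]
  outer s hs := (h₁.outer s hs).smul (h₂.outer s hs)
  norm_outer s z := by
    rw [norm_mul, norm_mul, h₁.norm_outer s, h₂.norm_outer s,
      Real.mul_rpow (norm_nonneg _) (norm_nonneg _)]
  root m hm z := by rw [mul_pow, h₁.root m hm, h₂.root m hm]
  eq z hz := by rw [h₁.eq z hz, h₂.eq z hz]; ring

theorem innerOuter_const (c : ℂ) :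
    InnerOuter (fun _ => c) (fun _ => 1) (fun s _ => c ^ (s : ℂ)) where
  inner := diffContOnCl_const
  norm_le z _ := by simp
  norm_eq z _ := by simp
  outer s _ := diffContOnCl_const
  norm_outer s z := by simp [norm_cpow_real]
  root m hm z := by simpa using cpow_nat_inv_pow c hm
  eq z _ := by simp

theorem re_nonneg_one_sub_mul {b z : ℂ} (hb : ‖b‖ ≤ 1) (hz : ‖z‖ ≤ 1) :
    0 ≤ (1 - b * z).re := by
  have h1 : ‖b * z‖ ≤ 1 := by
    rw [norm_mul]; exact mul_le_one₀ hb (norm_nonneg _) hz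
  have h2 := (re_le_norm (b * z)).trans h1
  simp only [sub_re, one_re]
  linarith

theorem re_pos_one_sub_mul {b z : ℂ} (hb : ‖b‖ ≤ 1) (hz : ‖z‖ < 1) :
    0 < (1 - b * z).re := by
  have h1 : ‖b * z‖ < 1 := by
    rw [norm_mul]
    exact (mul_le_of_le_one_left (norm_nonneg _) hb).trans_lt hz
  have h2 := (re_le_norm (b * z)).trans_lt h1
  simp only [sub_re, one_re]
  linarith

/-- `1 - bz` has nonnegative real part on the closed disc, hence avoids the branch cut. It may
vanish on the circle when `|b| = 1`, but a power with `s > 0` is continuous there. -/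
theorem diffContOnCl_one_sub_mul_cpow {b : ℂ} (hb : ‖b‖ ≤ 1) {s : ℝ} (hs : 0 < s) :
    DiffContOnCl ℂ (fun z => (1 - b * z) ^ (s : ℂ)) (ball 0 1) where
  differentiableOn z hz := by
    refine DifferentiableAt.differentiableWithinAt ?_
    refine DifferentiableAt.cpow (by fun_prop) (by fun_prop) (Or.inl ?_)
    exact re_pos_one_sub_mul hb (by simpa using hz)
  continuousOn z hz := by
    rw [closure_ball _ one_ne_zero] at hz
    have h1 : ContinuousAt (fun x : ℂ × ℂ => x.1 ^ x.2) (1 - b * z, (s : ℂ)) :=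
      continuousAt_cpow_of_re_pos
        (Or.inl (re_nonneg_one_sub_mul hb (by simpa using hz))) (by simpa using hs)
    have h2 : ContinuousAt (fun w : ℂ => ((1 - b * w, (s : ℂ)) : ℂ × ℂ)) z := by fun_prop
    exact (ContinuousAt.comp (f := fun w : ℂ => ((1 - b * w, (s : ℂ)) : ℂ × ℂ)) h1
      h2).continuousWithinAt

theorem innerOuter_one_sub_mul {b : ℂ} (hb : ‖b‖ ≤ 1) :
    InnerOuter (fun z => 1 - b * z) (fun _ => 1) (fun s z => (1 - b * z) ^ (s : ℂ)) where
  inner := diffContOnCl_const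
  norm_le z _ := by simp
  norm_eq z _ := by simp
  outer s hs := diffContOnCl_one_sub_mul_cpow hb hs
  norm_outer s z := by simp [norm_cpow_real]
  root m hm z := by simpa using cpow_nat_inv_pow (1 - b * z) hm
  eq z _ := by simp

/-- The sign of the right-hand side shows that a Blaschke factor is bounded by `1` in the disc and
unimodular on the circle. -/
theorem norm_one_sub_conj_mul_sq_sub (a z : ℂ) :
    ‖1 - (starRingEnd ℂ) a * z‖ ^ 2 - ‖z - a‖ ^ 2 = (1 - ‖a‖ ^ 2) * (1 - ‖z‖ ^ 2) := by
  simp only [← normSq_eq_norm_sq, normSq_apply, sub_re, sub_im, mul_re, mul_im, conj_re, conj_im,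
    one_re, one_im]
  ring

/-- A Blaschke factor carries the zero inside the disc; what remains vanishes only at the reflected
point `1/ā`. -/
theorem innerOuter_sub_of_norm_lt {a : ℂ} (ha : ‖a‖ < 1) :
    InnerOuter (fun z => z - a) (fun z => (z - a) / (1 - (starRingEnd ℂ) a * z))
      (fun s z => (1 - (starRingEnd ℂ) a * z) ^ (s : ℂ)) := by
  have hb : ‖(starRingEnd ℂ) a‖ < 1 := by simpa using ha
  have hne : ∀ z ∈ closedBall (0 : ℂ) 1, 1 - (starRingEnd ℂ) a * z ≠ 0 := fun z hz h => by
    have h0 : (0 : ℝ) < (1 - z * (starRingEnd ℂ) a).re :=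
      re_pos_one_sub_mul (by simpa using hz) hb
    rw [mul_comm, h] at h0
    simp at h0
  have h := innerOuter_one_sub_mul hb.le
  refine ⟨⟨?_, ?_⟩, fun z hz => ?_, fun z hz => ?_, h.outer, h.norm_outer, h.root, fun z hz => ?_⟩
  · exact fun z hz => DifferentiableAt.differentiableWithinAt
      (DifferentiableAt.div (by fun_prop) (by fun_prop) (hne z (ball_subset_closedBall hz)))
  · rw [closure_ball _ one_ne_zero]
    exact ContinuousOn.div (by fun_prop) (by fun_prop) hne
  · rw [norm_div, div_le_one (norm_pos_iff.2 (hne z hz))]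
    refine (sq_le_sq₀ (norm_nonneg _) (norm_nonneg _)).1 ?_
    have h1 := norm_one_sub_conj_mul_sq_sub a z
    have h2 : ‖z‖ ≤ 1 := by simpa using hz
    have h3 : 0 ≤ (1 - ‖a‖ ^ 2) * (1 - ‖z‖ ^ 2) :=
      mul_nonneg (by nlinarith [norm_nonneg a]) (by nlinarith [norm_nonneg z])
    linarith
  · rw [norm_div, div_eq_one_iff_eq (norm_ne_zero_iff.2 (hne z (sphere_subset_closedBall hz)))]
    refine (sq_eq_sq₀ (norm_nonneg _) (norm_nonneg _)).1 ?_
    have h1 := norm_one_sub_conj_mul_sq_sub a z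
    have h2 : ‖z‖ = 1 := by simpa using hz
    rw [h2] at h1
    linarith
  · simp [div_mul_cancel₀ _ (hne z hz)]

/-- A zero with `|a| ≥ 1` needs no Blaschke factor: `z - a = -a(1 - z/a)` and `|1/a| ≤ 1`. -/
theorem exists_innerOuter_sub (a : ℂ) : ∃ B G, InnerOuter (fun z => z - a) B G := by
  rcases lt_or_ge ‖a‖ 1 with ha | ha
  · exact ⟨_, _, innerOuter_sub_of_norm_lt ha⟩
  · have ha0 : a ≠ 0 := norm_pos_iff.1 (one_pos.trans_le ha)
    have h := (innerOuter_const (-a)).mul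
      (innerOuter_one_sub_mul (b := a⁻¹) (by rw [norm_inv]; exact inv_le_one_of_one_le₀ ha))
    have e : (fun z => -a * (1 - a⁻¹ * z)) = fun z => z - a := by
      funext z; field_simp; ring
    rw [e] at h
    exact ⟨_, _, h⟩

theorem exists_innerOuter (f : Polynomial ℂ) : ∃ B G, InnerOuter (fun z => f.eval z) B G := by
  have h := (IsAlgClosed.splits f).eq_prod_roots
  have key : ∀ m : Multiset ℂ, ∃ B G,
      InnerOuter (fun z => (m.map fun a => Polynomial.X - Polynomial.C a).prod.eval z) B G := by
    intro m
    induction m using Multiset.induction_on with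
    | empty => exact ⟨_, _, by simpa using innerOuter_const 1⟩
    | cons a m ih =>
      obtain ⟨B₁, G₁, h₁⟩ := exists_innerOuter_sub a
      obtain ⟨B₂, G₂, h₂⟩ := ih
      exact ⟨_, _, by simpa using h₁.mul h₂⟩
  obtain ⟨B, G, hBG⟩ := key f.roots
  rw [h]
  exact ⟨_, _, by simpa using (innerOuter_const f.leadingCoeff).mul hBG⟩

/-! ### Powers of the outer factor and `L^p` means -/

theorem enorm_rpow_eq_sq {x y : ℂ} {p : ℝ} (hp : 0 < p) (h : ‖x‖ = ‖y‖ ^ (p / 2)) :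
    ‖x‖ₑ ^ 2 = ‖y‖ₑ ^ p := by
  rw [← ofReal_norm x, h, ← ENNReal.ofReal_rpow_of_nonneg (norm_nonneg _) (by positivity),
    ofReal_norm, ← ENNReal.rpow_natCast, ← ENNReal.rpow_mul]
  congr 1
  push_cast
  ring

/-- Dilation by `r ≤ 1` contracts the `L^p` means of a polynomial. -/
theorem lintegral_eval_dilate_le (f : Polynomial ℂ) {p : ℝ} (hp : 0 < p) {r : ℝ} (hr0 : 0 ≤ r)
    (hr : r ≤ 1) :
    ∫⁻ t : UnitAddCircle, ‖f.eval ((r : ℂ) * (AddCircle.toCircle t : Circle))‖ₑ ^ p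
        ∂AddCircle.haarAddCircle ≤
      ∫⁻ t : UnitAddCircle, ‖f.eval ((AddCircle.toCircle t : Circle) : ℂ)‖ₑ ^ p
        ∂AddCircle.haarAddCircle := by
  -- With `g` the outer factor, `|f|^p ≤ |g^{p/2}|²` on the closed disc, with equality on the
  -- circle. The claim thus reduces to the case of `L²`, where dilation multiplies the Taylor
  -- coefficients by `r^n`.
  obtain ⟨B, G, h⟩ := exists_innerOuter f
  have hG := h.outer (p / 2) (by positivity)
  have hmaps : ∀ z : ℂ, ‖(r : ℂ) * z‖ ≤ ‖z‖ := fun z => by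
    rw [norm_mul, norm_real, Real.norm_of_nonneg hr0]
    exact mul_le_of_le_one_left (norm_nonneg _) hr
  have hGr : DiffContOnCl ℂ (fun z => G (p / 2) (r * z)) (ball 0 1) :=
    hG.comp (Differentiable.diffContOnCl (f := fun z : ℂ => (r : ℂ) * z) (by fun_prop)) fun z hz => by
      simp only [mem_ball_zero_iff] at hz ⊢
      exact (hmaps z).trans_lt hz
  have ha := hasTaylor_fourierCoeff hG
  set a : ℕ → ℂ := fun n => fourierCoeff (onCircle (G (p / 2))) n
  have har : HasTaylor (fun n => a n * (r : ℂ) ^ n) (fun z => G (p / 2) (r * z)) := fun z hz => by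
    refine (ha (r * z) ?_).congr_fun fun n => ?_
    · simp only [mem_ball_zero_iff] at hz ⊢
      exact (hmaps z).trans_lt hz
    · simp only [mul_pow]; ring
  have hle : ∀ z ∈ closedBall (0 : ℂ) 1, ‖f.eval z‖ₑ ^ p ≤ ‖G (p / 2) z‖ₑ ^ 2 := fun z hz => by
    rw [enorm_rpow_eq_sq hp (h.norm_outer _ z)]
    refine ENNReal.rpow_le_rpow ?_ hp.le
    rw [h.eq z hz, ← ofReal_norm, ← ofReal_norm, norm_mul]
    exact ENNReal.ofReal_le_ofReal (mul_le_of_le_one_left (norm_nonneg _) (h.norm_le z hz))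
  calc _ ≤ ∫⁻ t : UnitAddCircle, ‖onCircle (fun z => G (p / 2) (r * z)) t‖ₑ ^ 2
        ∂AddCircle.haarAddCircle := lintegral_mono fun t => hle _ (by
          rw [mem_closedBall_zero_iff]
          exact (hmaps _).trans (by simp [Circle.norm_coe]))
    _ = ∑' n, ‖a n * (r : ℂ) ^ n‖ₑ ^ 2 := (tsum_sq_taylor hGr har).symm
    _ ≤ ∑' n, ‖a n‖ₑ ^ 2 := ENNReal.tsum_le_tsum fun n => by
        gcongr
        rw [← ofReal_norm, ← ofReal_norm, norm_mul, norm_pow, norm_real, Real.norm_of_nonneg hr0]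
        exact ENNReal.ofReal_le_ofReal (mul_le_of_le_one_right (norm_nonneg _)
          (pow_le_one₀ hr0 hr))
    _ = ∫⁻ t, ‖onCircle (G (p / 2)) t‖ₑ ^ 2 ∂AddCircle.haarAddCircle := tsum_sq_taylor hG ha
    _ = _ := lintegral_congr fun t => by
        have hz : ((AddCircle.toCircle t : Circle) : ℂ) ∈ sphere (0 : ℂ) 1 := by
          simp [Circle.norm_coe]
        refine enorm_rpow_eq_sq hp ?_
        rw [onCircle, h.norm_outer, h.eq _ (sphere_subset_closedBall hz), norm_mul,
          h.norm_eq _ hz, one_mul]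

/-! ### Carleman's inequality -/

theorem enorm_sum_sq_le {ι : Type*} (s : Finset ι) (f : ι → ℂ) :
    ‖∑ i ∈ s, f i‖ₑ ^ 2 ≤ s.card * ∑ i ∈ s, ‖f i‖ₑ ^ 2 := by
  have h : ‖∑ i ∈ s, f i‖₊ ^ 2 ≤ s.card * ∑ i ∈ s, ‖f i‖₊ ^ 2 :=
    (pow_le_pow_left' (nnnorm_sum_le _ _) 2).trans sq_sum_le_card_mul_sum_sq
  simp only [enorm_eq_nnnorm]
  exact_mod_cast h

/-- Cauchy–Schwarz over the `n + 1` pairs with sum `n` costs a factor `n + 1`, which the extra power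
in the weight pays for. The other `k` powers only decrease when `n` is replaced by the first index
of the pair. -/
theorem tsum_sq_convolution_div_le (a b : ℕ → ℂ) (k : ℕ) :
    ∑' n : ℕ, ‖∑ x ∈ Finset.HasAntidiagonal.antidiagonal n, a x.1 * b x.2‖ₑ ^ 2 /
        ((n : ℝ≥0∞) + 1) ^ (k + 1) ≤
      (∑' n : ℕ, ‖a n‖ₑ ^ 2 / ((n : ℝ≥0∞) + 1) ^ k) * ∑' n, ‖b n‖ₑ ^ 2 := by
  have h1 : ∀ n : ℕ, ‖∑ x ∈ Finset.HasAntidiagonal.antidiagonal n, a x.1 * b x.2‖ₑ ^ 2 /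
      ((n : ℝ≥0∞) + 1) ^ (k + 1) ≤ ∑ x ∈ Finset.HasAntidiagonal.antidiagonal n,
        (‖a x.1‖ₑ ^ 2 / ((x.1 : ℝ≥0∞) + 1) ^ k) * ‖b x.2‖ₑ ^ 2 := fun n => by
    have h0 : ((n : ℝ≥0∞) + 1) ≠ 0 := by positivity
    have ht : ((n : ℝ≥0∞) + 1) ≠ ∞ := by finiteness
    rw [pow_succ' (_ + 1 : ℝ≥0∞), ENNReal.div_le_iff (by positivity) (by finiteness)]
    refine (enorm_sum_sq_le _ _).trans ?_
    rw [Finset.Nat.card_antidiagonal, mul_comm _ (_ * _), mul_assoc]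
    push_cast
    refine mul_le_mul_right ?_ _
    rw [Finset.mul_sum]
    refine Finset.sum_le_sum fun x hx => ?_
    rw [enorm_mul, mul_pow, ← mul_assoc]
    refine mul_le_mul_left ?_ _
    rw [← mul_div_assoc, ENNReal.le_div_iff_mul_le (Or.inl (by positivity))
      (Or.inl (by finiteness)), mul_comm]
    gcongr
    exact_mod_cast (Finset.HasAntidiagonal.mem_antidiagonal.1 hx) ▸ Nat.le_add_right _ _
  refine (ENNReal.tsum_le_tsum h1).trans (le_of_eq ?_)
  rw [← ENNReal.tsum_mul_right]
  simp only [← ENNReal.tsum_mul_left]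
  rw [← ENNReal.tsum_prod]
  rw [← Finset.HasAntidiagonal.sigmaAntidiagonalEquivProd.tsum_eq, ENNReal.tsum_sigma']
  refine tsum_congr fun n => ?_
  rw [tsum_fintype, ← Finset.sum_coe_sort]
  rfl

/-- Carleman's inequality, for the exponent `2 / (k + 1)`. -/
theorem tsum_sq_coeff_div_le (f : Polynomial ℂ) (k : ℕ) :
    ∑' n : ℕ, ‖f.coeff n‖ₑ ^ 2 / ((n : ℝ≥0∞) + 1) ^ k ≤
      (∫⁻ t : UnitAddCircle, ‖f.eval ((AddCircle.toCircle t : Circle) : ℂ)‖ₑ ^ (2 / (k + 1 : ℝ))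
        ∂AddCircle.haarAddCircle) ^ (k + 1) := by
  obtain ⟨B, G, h⟩ := exists_innerOuter f
  -- The `(k+1)`-st root of the outer factor: on the circle `|g|² = |f|^{2/(k+1)}`, and `f = (B g)
  -- g^k` in the disc.
  set g := G ((k + 1 : ℕ) : ℝ)⁻¹ with hg
  have hgd : DiffContOnCl ℂ g (ball 0 1) := h.outer _ (by positivity)
  set I := ∫⁻ t : UnitAddCircle, ‖f.eval ((AddCircle.toCircle t : Circle) : ℂ)‖ₑ ^ (2 / (k + 1 : ℝ))
        ∂AddCircle.haarAddCircle with hI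
  have hb := hasTaylor_fourierCoeff hgd
  set b : ℕ → ℂ := fun n => fourierCoeff (onCircle g) n
  have hgc : ∀ t, ‖onCircle g t‖ₑ ^ 2 =
      ‖f.eval ((AddCircle.toCircle t : Circle) : ℂ)‖ₑ ^ (2 / (k + 1 : ℝ)) := fun t => by
    have hz : ((AddCircle.toCircle t : Circle) : ℂ) ∈ sphere (0 : ℂ) 1 := by simp [Circle.norm_coe]
    refine enorm_rpow_eq_sq (by positivity) ?_
    rw [onCircle, hg, h.norm_outer, h.eq _ (sphere_subset_closedBall hz), norm_mul,
      h.norm_eq _ hz, one_mul]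
    congr 1
    push_cast
    field_simp
  have hbI : ∑' n, ‖b n‖ₑ ^ 2 = I := by
    rw [tsum_sq_taylor hgd hb]
    exact lintegral_congr hgc
  -- `B g` has squared `L²` norm `I` because `B` is unimodular on the circle. Each further factor
  -- `g` convolves the coefficients with `b`, which contributes another `I` and one power of the
  -- weight.
  have key : ∀ j : ℕ, ∃ c : ℕ → ℂ, HasTaylor c (fun z => B z * g z * g z ^ j) ∧
      ∑' n : ℕ, ‖c n‖ₑ ^ 2 / ((n : ℝ≥0∞) + 1) ^ j ≤ I ^ (j + 1) := by
    intro j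
    induction j with
    | zero =>
      have hd : DiffContOnCl ℂ (fun z => B z * g z) (ball 0 1) := h.inner.smul hgd
      refine ⟨_, by simpa using hasTaylor_fourierCoeff hd, ?_⟩
      simp only [pow_zero, div_one, zero_add, pow_one]
      rw [tsum_sq_taylor hd (hasTaylor_fourierCoeff hd)]
      refine le_of_eq (lintegral_congr fun t => ?_)
      rw [← hgc t]
      have hz : ((AddCircle.toCircle t : Circle) : ℂ) ∈ sphere (0 : ℂ) 1 := by
        simp [Circle.norm_coe]
      simp only [onCircle, enorm_mul]
      rw [← ofReal_norm (B _), h.norm_eq _ hz]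
      simp
    | succ j ih =>
      obtain ⟨c, hc, hle⟩ := ih
      refine ⟨_, by simpa [pow_succ, mul_assoc] using hc.mul hb, ?_⟩
      refine (tsum_sq_convolution_div_le _ _ _).trans ?_
      rw [hbI, pow_succ _ (j + 1)]
      gcongr
  obtain ⟨c, hc, hle⟩ := key k
  have hf : HasTaylor c (fun z => f.eval z) := fun z hz => by
    change HasSum _ (f.eval z)
    rw [h.eq z (ball_subset_closedBall hz), ← h.root (k + 1) (by omega), pow_succ', ← mul_assoc]
    exact hc z hz
  rw [(hasTaylor_polynomial f).unique hf]
  exact hle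

end Disc

/-! ### Integration over one coordinate of the infinite torus -/

instance : IsProbabilityMeasure torusMeasure := isProbabilityMeasure_torusMeasure

open Classical in
theorem map_add_single_torusMeasure (q : Nat.Primes) (t : UnitAddCircle) :
    torusMeasure.map (fun x => x + Pi.single q t) = torusMeasure := by
  have h := Measure.infinitePi_map_pi
    (fun _ : Nat.Primes => (AddCircle.haarAddCircle : Measure UnitAddCircle))
    (f := fun i y => y + (Pi.single q t : InfTorus) i) (fun i => measurable_add_const _)
  simp only [map_add_right_eq_self] at h
  exact h

open Classical in
-- Translating the coordinate `q` by `t` preserves the measure; averaging over `t` gives the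
-- identity. It plays the role of Fubini without splitting off a factor of the torus.
theorem lintegral_torusMeasure_eq (q : Nat.Primes) {F : InfTorus → ℝ≥0∞} (hF : Measurable F) :
    ∫⁻ x, F x ∂torusMeasure =
      ∫⁻ x, ∫⁻ t, F (x + Pi.single q t) ∂AddCircle.haarAddCircle ∂torusMeasure := by
  have hm : Measurable fun y : InfTorus × UnitAddCircle => y.1 + (Pi.single q y.2 : InfTorus) := by
    refine measurable_pi_iff.2 fun i => ?_
    by_cases hi : i = q
    · subst hi
      simp only [Pi.add_apply, Pi.single_eq_same]
      fun_prop
    · simp only [Pi.add_apply, Pi.single_eq_of_ne hi, add_zero]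
      fun_prop
  have hm' : AEMeasurable (Function.uncurry fun (x : InfTorus) (t : UnitAddCircle) =>
      F (x + Pi.single q t)) (torusMeasure.prod AddCircle.haarAddCircle) :=
    (hF.comp hm).aemeasurable
  rw [lintegral_lintegral_swap hm']
  have h : ∀ t : UnitAddCircle, ∫⁻ x, F (x + Pi.single q t) ∂torusMeasure =
      ∫⁻ x, F x ∂torusMeasure := fun t => by
    conv_rhs => rw [← map_add_single_torusMeasure q t]
    rw [lintegral_map hF (measurable_add_const _)]
  simp [h]

/-! ### Prime exponents -/

/-- The exponent of the prime `q` in `n`. -/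
def primeExp (q : Nat.Primes) (n : ℕ+) : ℕ :=
  Multiset.count q (PNat.factorMultiset n : Multiset Nat.Primes)

/-- The set of the prime factors of `n`. -/
def primeSupport (n : ℕ+) : Finset Nat.Primes :=
  Multiset.toFinset (PNat.factorMultiset n : Multiset Nat.Primes)

theorem primeExp_eq_zero {q : Nat.Primes} {n : ℕ+} (h : q ∉ primeSupport n) : primeExp q n = 0 :=
  Multiset.count_eq_zero.2 fun hq => h (Multiset.mem_toFinset.2 hq)

theorem eq_of_primeExp_eq {n m : ℕ+} (h : ∀ q, primeExp q n = primeExp q m) : n = m := by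
  have : (PNat.factorMultiset n) = PNat.factorMultiset m := Multiset.ext.2 h
  rw [← PNat.prod_factorMultiset n, this, PNat.prod_factorMultiset]

theorem coe_eq_prod_primeExp {S : Finset Nat.Primes} {n : ℕ+} (h : primeSupport n ⊆ S) :
    (n : ℕ) = ∏ q ∈ S, (q : ℕ) ^ primeExp q n := by
  have h1 : (n : ℕ) = (Multiset.map (fun p : Nat.Primes => (p : ℕ))
      (PNat.factorMultiset n : Multiset Nat.Primes)).prod := by
    conv_lhs => rw [← PNat.prod_factorMultiset n]
    exact PrimeMultiset.coe_prod _
  refine h1.trans ((Finset.prod_multiset_map_count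
    (PNat.factorMultiset n : Multiset Nat.Primes) _).trans ?_)
  refine Finset.prod_subset h fun q _ hq => ?_
  exact (congrArg _ (primeExp_eq_zero hq)).trans (pow_zero _)

open Classical in
theorem monomial_add_single (n : ℕ+) (x : InfTorus) (q : Nat.Primes) (t : UnitAddCircle) :
    monomial n (x + Pi.single q t) =
      ((AddCircle.toCircle t : Circle) : ℂ) ^ primeExp q n * monomial n x := by
  have h : ∀ m : Multiset Nat.Primes, (Multiset.map (fun p : Nat.Primes =>
      ((AddCircle.toCircle ((x + Pi.single q t : InfTorus) p) : Circle) : ℂ)) m).prod =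
      ((AddCircle.toCircle t : Circle) : ℂ) ^ Multiset.count q m *
      (Multiset.map (fun p : Nat.Primes => ((AddCircle.toCircle (x p) : Circle) : ℂ)) m).prod := by
    intro m
    induction m using Multiset.induction_on with
    | empty => simp
    | cons p m ih =>
      rw [Multiset.map_cons, Multiset.prod_cons, ih, Multiset.map_cons, Multiset.prod_cons]
      by_cases hp : q = p
      · subst hp
        rw [Multiset.count_cons_self, Pi.add_apply, Pi.single_eq_same, AddCircle.toCircle_add,
          Circle.coe_mul]
        ring
      · rw [Multiset.count_cons_of_ne hp, Pi.add_apply, Pi.single_eq_of_ne (Ne.symm hp), add_zero]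
        ring
  exact h _

/-! ### Slices of the Bohr lift -/

/-- The Bohr lift of `P` along the coordinate `q` through `x`, as a polynomial. -/
def slice (P : DirPoly) (q : Nat.Primes) (x : InfTorus) : Polynomial ℂ :=
  ∑ n ∈ P.support, Polynomial.monomial (primeExp q n) (P n * monomial n x)

theorem eval_slice (P : DirPoly) (q : Nat.Primes) (x : InfTorus) (z : ℂ) :
    (slice P q x).eval z = ∑ n ∈ P.support, P n * monomial n x * z ^ primeExp q n := by
  simp [slice, Polynomial.eval_finsetSum]

/-- The part of `P` with the exponent of `q` equal to `j`. -/
def expPart (P : DirPoly) (q : Nat.Primes) (j : ℕ) : DirPoly := P.filter fun n => primeExp q n = j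

/-- The coefficients of a slice are again Bohr lifts, so a one-variable estimate in `q` can be
followed by an induction on the remaining primes. -/
theorem coeff_slice (P : DirPoly) (q : Nat.Primes) (x : InfTorus) (j : ℕ) :
    (slice P q x).coeff j = bohrLift (expPart P q j) x := by
  classical
  simp only [slice, Polynomial.finsetSum_coeff, Polynomial.coeff_monomial]
  rw [← Finset.sum_filter, bohrLift, Finsupp.sum, expPart, Finsupp.support_filter]
  refine Finset.sum_congr rfl fun n hn => ?_
  rw [Finsupp.filter_apply_pos (fun n => primeExp q n = j) P (Finset.mem_filter.1 hn).2]

open Classical in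
theorem bohrLift_add_single (P : DirPoly) (q : Nat.Primes) (x : InfTorus) (t : UnitAddCircle) :
    bohrLift P (x + Pi.single q t) = (slice P q x).eval ((AddCircle.toCircle t : Circle) : ℂ) := by
  rw [eval_slice, bohrLift, Finsupp.sum]
  refine Finset.sum_congr rfl fun n _ => ?_
  rw [monomial_add_single]
  ring

/-! ### Multipliers -/

/-- The Dirichlet polynomial with coefficients `a_n c_n`. -/
def mulPoly (c : ℕ+ → ℂ) (P : DirPoly) : DirPoly :=
  Finsupp.onFinset P.support (fun n => P n * c n) fun n h => by
    rw [Finsupp.mem_support_iff]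
    exact left_ne_zero_of_mul h

@[simp] theorem mulPoly_apply (c : ℕ+ → ℂ) (P : DirPoly) (n : ℕ+) : mulPoly c P n = P n * c n := rfl

theorem bohrLift_mulPoly (c : ℕ+ → ℂ) (P : DirPoly) (x : InfTorus) :
    bohrLift (mulPoly c P) x = ∑ n ∈ P.support, P n * c n * monomial n x :=
  Finsupp.onFinset_sum _ (by simp)

/-- The multiplier is the dilation `z_q ↦ r z_q`; the one-variable contraction applies on each slice
in the coordinate `q`. -/
theorem hardyPolyNorm_mulPoly_pow_le {p : ℝ} (hp : 0 < p) (q : Nat.Primes) {r : ℝ} (hr0 : 0 ≤ r)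
    (hr : r ≤ 1) (P : DirPoly) :
    hardyPolyNorm p (mulPoly (fun n => (r : ℂ) ^ primeExp q n) P) ≤ hardyPolyNorm p P := by
  classical
  refine ENNReal.rpow_le_rpow ?_ (by positivity)
  rw [lintegral_torusMeasure_eq q ((measurable_bohrLift _).enorm.pow_const _),
    lintegral_torusMeasure_eq q ((measurable_bohrLift _).enorm.pow_const _)]
  refine lintegral_mono fun x => ?_
  have h : ∀ t : UnitAddCircle, bohrLift (mulPoly (fun n => (r : ℂ) ^ primeExp q n) P)
      (x + Pi.single q t) =
      (slice P q x).eval ((r : ℂ) * ((AddCircle.toCircle t : Circle) : ℂ)) := fun t => by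
    rw [bohrLift_mulPoly, eval_slice]
    refine Finset.sum_congr rfl fun n _ => ?_
    rw [monomial_add_single, mul_pow]
    ring
  simp only [h, bohrLift_add_single]
  exact lintegral_eval_dilate_le _ hp hr0 hr

theorem hardyPolyNorm_mulPoly_prod_le {p : ℝ} (hp : 0 < p) (S : Finset Nat.Primes)
    {r : Nat.Primes → ℝ} (hr0 : ∀ q, 0 ≤ r q) (hr : ∀ q, r q ≤ 1) (P : DirPoly) :
    hardyPolyNorm p (mulPoly (fun n => ∏ q ∈ S, (r q : ℂ) ^ primeExp q n) P) ≤
      hardyPolyNorm p P := by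
  classical
  induction S using Finset.induction_on with
  | empty =>
    refine le_of_eq (congrArg _ ?_)
    ext n
    simp
  | insert q S hq ih =>
    refine le_trans (le_of_eq (congrArg _ ?_))
      ((hardyPolyNorm_mulPoly_pow_le hp q (hr0 q) (hr q) _).trans ih)
    ext n
    simp only [mulPoly_apply, Finset.prod_insert hq]
    ring

/-- The translations `P ↦ P_σ`, `σ ≥ 0`, are contractions of `ℋ^p`. -/
theorem hardyPolyNorm_translatePoly_le_self {p : ℝ} (hp : 0 < p) {σ : ℝ} (hσ : 0 ≤ σ)
    (P : DirPoly) : hardyPolyNorm p (translatePoly σ P) ≤ hardyPolyNorm p P := by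
  classical
  -- `n^{-σ}` is the product of the `(q^{-σ})^{ν_q(n)}`, so translation dilates each coordinate by
  -- `q^{-σ} ≤ 1`. Only the finitely many primes dividing some `n` in the support matter.
  refine le_trans (le_of_eq (congrArg _ ?_)) (hardyPolyNorm_mulPoly_prod_le hp
    (P.support.biUnion primeSupport) (r := fun q => ((q : ℕ) : ℝ) ^ (-σ)) (fun q => by positivity)
    (fun q => Real.rpow_le_one_of_one_le_of_nonpos (by exact_mod_cast q.2.one_le) (by linarith)) P)
  ext n
  by_cases hn : n ∈ P.support
  · change P n * ((n : ℕ) : ℂ) ^ (-(σ : ℂ)) = P n * _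
    congr 1
    have h := coe_eq_prod_primeExp (Finset.subset_biUnion_of_mem primeSupport hn)
    have h2 : ((n : ℕ) : ℝ) ^ (-σ) =
        ∏ q ∈ P.support.biUnion primeSupport, (((q : ℕ) : ℝ) ^ (-σ)) ^ primeExp q n := by
      rw [h]
      push_cast
      rw [← Real.finsetProd_rpow _ _ (fun q _ => by positivity)]
      refine Finset.prod_congr rfl fun q _ => ?_
      rw [← Real.rpow_natCast, ← Real.rpow_natCast, ← Real.rpow_mul (by positivity),
        ← Real.rpow_mul (by positivity), mul_comm]
    rw [← Complex.ofReal_neg, ← Complex.ofReal_natCast, ← Complex.ofReal_cpow (by positivity), h2]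
    push_cast
    rfl
  · rw [Finsupp.notMem_support_iff] at hn
    simp [translatePoly, translate, hn]

/-! ### Minkowski's integral inequality for finite sums -/

/-- The `ℓ^m` norm of the vector of integrals is at most the integral of the `ℓ^m` norms, `m = k +
1`. Hölder's inequality gives `A ≤ A^{1-1/m} J`, and one divides by `A^{1-1/m}`; this needs `0 < A <
∞`, whence the preliminary cases. -/
theorem sum_lintegral_pow_le {X ι : Type*} [MeasurableSpace X] (μ : Measure X) (s : Finset ι)
    {u : ι → X → ℝ≥0∞} (hu : ∀ i, Measurable (u i)) (k : ℕ) :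
    ∑ i ∈ s, (∫⁻ x, u i x ∂μ) ^ (k + 1) ≤
      (∫⁻ x, (∑ i ∈ s, u i x ^ (k + 1)) ^ ((k + 1 : ℕ) : ℝ)⁻¹ ∂μ) ^ (k + 1) := by
  rcases Nat.eq_zero_or_pos k with rfl | hk
  · simp [lintegral_finsetSum s fun i _ => hu i]
  set m : ℝ := ((k + 1 : ℕ) : ℝ) with hm
  have hm1 : 1 < m := by rw [hm]; exact_mod_cast Nat.succ_lt_succ hk
  have hm0 : 0 < m := one_pos.trans hm1
  set J := ∫⁻ x, (∑ i ∈ s, u i x ^ (k + 1)) ^ m⁻¹ ∂μ with hJ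
  set A := ∑ i ∈ s, (∫⁻ x, u i x ∂μ) ^ (k + 1) with hA
  by_cases hJt : J = ∞
  · rw [hJt, ENNReal.top_pow (by omega)]; exact le_top
  by_cases hA0 : A = 0
  · rw [hA0]; exact zero_le
  have hI : ∀ i ∈ s, ∫⁻ x, u i x ∂μ ≠ ∞ := fun i hi => by
    refine ne_top_of_le_ne_top hJt (lintegral_mono fun x => ?_)
    have h1 : u i x ^ (k + 1) ≤ ∑ i ∈ s, u i x ^ (k + 1) :=
      Finset.single_le_sum (f := fun i => u i x ^ (k + 1)) (fun _ _ => zero_le) hi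
    have h2 := ENNReal.rpow_le_rpow h1 (inv_nonneg.2 hm0.le)
    rwa [← ENNReal.rpow_natCast, ← ENNReal.rpow_mul, mul_inv_cancel₀ hm0.ne',
      ENNReal.rpow_one] at h2
  have hAt : A ≠ ∞ := (ENNReal.sum_lt_top.2 fun i hi => ENNReal.pow_lt_top (hI i hi).lt_top).ne
  have hpq : (m / (m - 1)).HolderConjugate m := (Real.HolderConjugate.conjExponent hm1).symm
  have key : A ≤ A ^ (1 - m⁻¹) * J := by
    calc A = ∑ i ∈ s, ∫⁻ x, (∫⁻ x, u i x ∂μ) ^ k * u i x ∂μ := by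
          refine Finset.sum_congr rfl fun i _ => ?_
          rw [lintegral_const_mul _ (hu i), pow_succ]
      _ = ∫⁻ x, ∑ i ∈ s, (∫⁻ x, u i x ∂μ) ^ k * u i x ∂μ :=
          (lintegral_finsetSum s fun i _ => (hu i).const_mul _).symm
      _ ≤ ∫⁻ x, A ^ (1 - m⁻¹) * (∑ i ∈ s, u i x ^ (k + 1)) ^ m⁻¹ ∂μ := by
          refine lintegral_mono fun x => ?_
          refine (ENNReal.inner_le_Lp_mul_Lq s _ _ hpq).trans (le_of_eq ?_)
          congr 1
          · rw [hA]
            congr 1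
            · refine Finset.sum_congr rfl fun i _ => ?_
              rw [← ENNReal.rpow_natCast, ← ENNReal.rpow_mul, ← ENNReal.rpow_natCast]
              congr 1
              have : m - 1 ≠ 0 := by linarith
              have : (k : ℝ) = m - 1 := by rw [hm]; push_cast; ring
              rw [← hm, this]
              field_simp
            · field_simp
          · rw [one_div]
            congr 1
            refine Finset.sum_congr rfl fun i _ => ?_
            rw [← ENNReal.rpow_natCast]
      _ = A ^ (1 - m⁻¹) * J := lintegral_const_mul _
          ((Finset.measurable_fun_sum _ fun i _ => (hu i).pow_const _).pow_const _)
  have h1 : A ^ m⁻¹ ≤ J := by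
    have h2 : A = A ^ (1 - m⁻¹) * A ^ m⁻¹ := by
      rw [← ENNReal.rpow_add _ _ hA0 hAt, sub_add_cancel, ENNReal.rpow_one]
    have h3 : A ^ (1 - m⁻¹) ≠ 0 := by
      simp [ENNReal.rpow_eq_zero_iff, hA0, hAt]
    have h4 : A ^ (1 - m⁻¹) ≠ ∞ := ENNReal.rpow_ne_top_of_ne_zero hA0 hAt
    have h5 : A ^ (1 - m⁻¹) * A ^ m⁻¹ ≤ A ^ (1 - m⁻¹) * J := h2 ▸ key
    exact (ENNReal.mul_le_mul_iff_right h3 h4).1 h5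
  calc A = (A ^ m⁻¹) ^ (k + 1) := by
        rw [← ENNReal.rpow_natCast, ← ENNReal.rpow_mul, inv_mul_cancel₀ hm0.ne', ENNReal.rpow_one]
    _ ≤ J ^ (k + 1) := pow_le_pow_left' h1 _

/-! ### The weighted `ℓ^2` inequality of Helson -/

/-- Induction over the variables. Terms are grouped by the exponent `j` of the new prime `q`, and
the induction hypothesis bounds each group by an integral. Minkowski's inequality moves the sum over
`j` inside, and Carleman's inequality bounds it on each slice. The condition off `S` says that `P`
is a fixed monomial times a polynomial in the variables of `S`; it passes to `expPart`. -/
theorem sum_sq_div_prod_le (k : ℕ) (S : Finset Nat.Primes) (P : DirPoly)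
    (hP : ∀ n ∈ P.support, ∀ n' ∈ P.support, ∀ q ∉ S, primeExp q n = primeExp q n') :
    ∑ n ∈ P.support, ‖P n‖ₑ ^ 2 / ∏ q ∈ S, ((primeExp q n : ℝ≥0∞) + 1) ^ k ≤
      (∫⁻ x, ‖bohrLift P x‖ₑ ^ (2 / (k + 1 : ℝ)) ∂torusMeasure) ^ (k + 1) := by
  classical
  induction S using Finset.induction_on generalizing P with
  | empty =>
    rcases P.support.eq_empty_or_nonempty with h0 | ⟨n, hn⟩
    · simp [h0]
    -- With no free prime all exponents agree, so at most one term is left.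
    have hs : P.support = {n} := Finset.eq_singleton_iff_unique_mem.2
      ⟨hn, fun n' hn' => eq_of_primeExp_eq fun q => hP n' hn' n hn q (Finset.notMem_empty q)⟩
    have h1 : ∀ x, ‖bohrLift P x‖ₑ = ‖P n‖ₑ := fun x => by
      have h2 : ‖monomial n x‖ₑ = 1 := by rw [← ofReal_norm, norm_monomial]; simp
      rw [bohrLift, Finsupp.sum, hs, Finset.sum_singleton, enorm_mul, h2, mul_one]
    simp only [h1, hs, Finset.sum_singleton, Finset.prod_empty, div_one, lintegral_const,
      measure_univ, mul_one]
    rw [← ENNReal.rpow_natCast, ← ENNReal.rpow_natCast, ← ENNReal.rpow_mul]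
    refine le_of_eq (congrArg _ ?_)
    push_cast
    field_simp
  | insert q S hq ih =>
    obtain ⟨N, hN⟩ : ∃ N, ∀ n ∈ P.support, primeExp q n ∈ Finset.range N :=
      ⟨P.support.sup (primeExp q) + 1, fun n hn =>
        Finset.mem_range.2 (Nat.lt_succ_of_le (Finset.le_sup (f := primeExp q) hn))⟩
    have hpart : ∀ j, ∑ n ∈ P.support with primeExp q n = j,
        ‖P n‖ₑ ^ 2 / ∏ q ∈ insert q S, ((primeExp q n : ℝ≥0∞) + 1) ^ k ≤
        (∫⁻ x, (‖bohrLift (expPart P q j) x‖ₑ ^ 2 / ((j : ℝ≥0∞) + 1) ^ k) ^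
          ((k + 1 : ℕ) : ℝ)⁻¹ ∂torusMeasure) ^ (k + 1) := fun j => by
      have hw0 : ((j : ℝ≥0∞) + 1) ^ k ≠ 0 := by positivity
      have hwt : ((j : ℝ≥0∞) + 1) ^ k ≠ ∞ := by finiteness
      have hih := ih (expPart P q j) fun n hn n' hn' q' hq' => by
        rw [expPart, Finsupp.support_filter, Finset.mem_filter] at hn hn'
        by_cases h : q' = q
        · rw [h, hn.2, hn'.2]
        · exact hP n hn.1 n' hn'.1 q' (by simp [h, hq'])
      have e1 : ∑ n ∈ P.support with primeExp q n = j,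
          ‖P n‖ₑ ^ 2 / ∏ q ∈ insert q S, ((primeExp q n : ℝ≥0∞) + 1) ^ k =
          (((j : ℝ≥0∞) + 1) ^ k)⁻¹ * ∑ n ∈ (expPart P q j).support,
            ‖expPart P q j n‖ₑ ^ 2 / ∏ q ∈ S, ((primeExp q n : ℝ≥0∞) + 1) ^ k := by
        rw [expPart, Finsupp.support_filter, Finset.mul_sum]
        refine Finset.sum_congr rfl fun n hn => ?_
        have hn2 := (Finset.mem_filter.1 hn).2
        rw [Finsupp.filter_apply_pos (fun n => primeExp q n = j) P hn2, Finset.prod_insert hq, hn2,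
          div_eq_mul_inv, ENNReal.mul_inv (Or.inl hw0) (Or.inl hwt), div_eq_mul_inv]
        ring
      have e2 : ∀ x, (‖bohrLift (expPart P q j) x‖ₑ ^ 2 / ((j : ℝ≥0∞) + 1) ^ k) ^
          ((k + 1 : ℕ) : ℝ)⁻¹ = ((((j : ℝ≥0∞) + 1) ^ k)⁻¹) ^ ((k + 1 : ℕ) : ℝ)⁻¹ *
            ‖bohrLift (expPart P q j) x‖ₑ ^ (2 / (k + 1 : ℝ)) := fun x => by
        rw [div_eq_mul_inv, ENNReal.mul_rpow_of_nonneg _ _ (by positivity), mul_comm,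
          ← ENNReal.rpow_natCast _ 2, ← ENNReal.rpow_mul]
        congr 2
        push_cast
        rw [div_eq_mul_inv]
      rw [e1]
      simp only [e2]
      rw [lintegral_const_mul _ ((measurable_bohrLift _).enorm.pow_const _), mul_pow,
        ← ENNReal.rpow_natCast (_ ^ ((k + 1 : ℕ) : ℝ)⁻¹), ← ENNReal.rpow_mul,
        inv_mul_cancel₀ (by positivity), ENNReal.rpow_one]
      gcongr
    rw [← Finset.sum_fiberwise_of_maps_to hN]
    refine (Finset.sum_le_sum fun j _ => hpart j).trans ?_
    refine (sum_lintegral_pow_le torusMeasure _ (fun j => Measurable.pow_const (Measurable.div_const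
      ((measurable_bohrLift _).enorm.pow_const _) _) _) k).trans ?_
    refine pow_le_pow_left' ?_ _
    rw [lintegral_torusMeasure_eq q ((measurable_bohrLift _).enorm.pow_const _)]
    refine lintegral_mono fun x => ?_
    simp only [bohrLift_add_single]
    -- Carleman's inequality in the coordinate `q`; the outer powers `k + 1` and `1/(k+1)` cancel.
    have hc := tsum_sq_coeff_div_le (slice P q x) k
    have hroot : ∀ y : ℝ≥0∞, (y ^ (k + 1)) ^ ((k + 1 : ℕ) : ℝ)⁻¹ = y := fun y => by
      rw [← ENNReal.rpow_natCast, ← ENNReal.rpow_mul, mul_inv_cancel₀ (by positivity),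
        ENNReal.rpow_one]
    have hroot' : ∀ y : ℝ≥0∞, (y ^ ((k + 1 : ℕ) : ℝ)⁻¹) ^ (k + 1) = y := fun y => by
      rw [← ENNReal.rpow_natCast, ← ENNReal.rpow_mul, inv_mul_cancel₀ (by positivity),
        ENNReal.rpow_one]
    simp only [hroot']
    refine le_trans ?_ (le_of_eq (hroot _))
    refine ENNReal.rpow_le_rpow (le_trans ?_ hc) (by positivity)
    simp only [← coeff_slice]
    exact ENNReal.sum_le_tsum _

/-- The number of divisors of `n`. -/
def divisorCount (n : ℕ+) : ℕ := ∏ q ∈ primeSupport n, (primeExp q n + 1)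

theorem divisorCount_pos (n : ℕ+) : 0 < divisorCount n :=
  Finset.prod_pos fun _ _ => Nat.succ_pos _

/-- Helson's inequality: the coefficients of an element of `ℋ^p`, `p ≥ 2 / (k + 1)`, are in a
weighted `ℓ^2`. -/
theorem sum_sq_div_divisorCount_le {p : ℝ} {k : ℕ} (hk : 2 / (k + 1 : ℝ) ≤ p) (P : DirPoly) :
    ∑ n ∈ P.support, ‖P n‖ₑ ^ 2 / (divisorCount n : ℝ≥0∞) ^ k ≤ hardyPolyNorm p P ^ 2 := by
  classical
  have h := sum_sq_div_prod_le k (P.support.biUnion primeSupport) P fun n hn n' hn' q hq => by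
    rw [Finset.mem_biUnion] at hq
    push Not at hq
    rw [primeExp_eq_zero (hq n hn), primeExp_eq_zero (hq n' hn')]
  have e : ∀ n ∈ P.support, ∏ q ∈ P.support.biUnion primeSupport,
      ((primeExp q n : ℝ≥0∞) + 1) ^ k = (divisorCount n : ℝ≥0∞) ^ k := fun n hn => by
    rw [divisorCount, Finset.prod_pow]
    push_cast
    congr 1
    refine (Finset.prod_subset (Finset.subset_biUnion_of_mem primeSupport hn) fun q _ hq => ?_).symm
    simp [primeExp_eq_zero hq]
  have hp0 : (0 : ℝ) < 2 / (k + 1 : ℝ) := by positivity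
  rw [Finset.sum_congr rfl fun n hn => by rw [e n hn]] at h
  refine h.trans ?_
  -- On a probability space the `L^p` norms increase with the exponent, which passes from `2/(k+1)`
  -- to `p`.
  have hmono := eLpNorm_le_eLpNorm_of_exponent_le (μ := torusMeasure) (f := bohrLift P)
    (ENNReal.ofReal_le_ofReal hk) (measurable_bohrLift P).aestronglyMeasurable
  have hp : 0 < p := hp0.trans_le hk
  rw [eLpNorm_eq_lintegral_rpow_enorm_toReal (by simpa using hp0) ENNReal.ofReal_ne_top,
    eLpNorm_eq_lintegral_rpow_enorm_toReal (by simpa using hp) ENNReal.ofReal_ne_top,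
    ENNReal.toReal_ofReal hp0.le, ENNReal.toReal_ofReal hp.le] at hmono
  refine le_trans (le_of_eq ?_) (pow_le_pow_left' hmono 2)
  rw [← ENNReal.rpow_natCast, ← ENNReal.rpow_natCast, ← ENNReal.rpow_mul]
  congr 1
  push_cast
  field_simp

/-! ### The divisor bound -/

/-- Prime by prime, `j + 1` is compared with `q^{εj}`. If `q^ε ≥ 2`, then `j + 1 ≤ 2^j ≤ q^{εj}`;
the primes below `B ≥ 2^{1/ε}` cost a factor `C₀` each. -/
theorem exists_divisorCount_le {ε : ℝ} (hε : 0 < ε) :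
    ∃ C : ℝ, 1 ≤ C ∧ ∀ n : ℕ+, (divisorCount n : ℝ) ≤ C * ((n : ℕ) : ℝ) ^ ε := by
  classical
  obtain ⟨B, hB⟩ := exists_nat_ge ((2 : ℝ) ^ (1 / ε))
  -- Chosen so that `j + 1 ≤ C₀ (1 + jε log 2) ≤ C₀ 2^{εj}` for all `j`.
  set C₀ : ℝ := max 1 (1 / (ε * Real.log 2)) with hC₀
  have hC1 : 1 ≤ C₀ := le_max_left _ _
  have hlog : 0 < ε * Real.log 2 := mul_pos hε (Real.log_pos one_lt_two)
  have hC2 : 1 ≤ C₀ * (ε * Real.log 2) := by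
    rw [← div_le_iff₀ hlog]; exact le_max_right _ _
  refine ⟨C₀ ^ B, one_le_pow₀ hC1, fun n => ?_⟩
  have hfac : ∀ q : Nat.Primes, ∀ j : ℕ,
      ((j : ℝ) + 1) ≤ (if (q : ℕ) < B then C₀ else 1) * (((q : ℕ) : ℝ) ^ ε) ^ j := by
    intro q j
    have hq2 : (2 : ℝ) ≤ (q : ℕ) := by exact_mod_cast q.2.two_le
    split_ifs with h
    · have h1 : Real.exp (ε * Real.log 2 * j) ≤ (((q : ℕ) : ℝ) ^ ε) ^ j := by
        have h3 : Real.exp (ε * Real.log 2 * j) = ((2 : ℝ) ^ ε) ^ j := by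
          rw [Real.rpow_def_of_pos two_pos, ← Real.exp_nat_mul]
          congr 1; ring
        rw [h3]
        gcongr
      have h2 := Real.add_one_le_exp (ε * Real.log 2 * j)
      have hj : (0 : ℝ) ≤ j := j.cast_nonneg
      calc (j : ℝ) + 1 ≤ C₀ * (ε * Real.log 2 * j + 1) := by nlinarith
        _ ≤ _ := by gcongr; exact h2.trans h1
    · have h1 : (2 : ℝ) ≤ ((q : ℕ) : ℝ) ^ ε := by
        have h3 : (2 : ℝ) ^ (1 / ε) ≤ (q : ℕ) := hB.trans (by exact_mod_cast not_lt.1 h)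
        calc (2 : ℝ) = ((2 : ℝ) ^ (1 / ε)) ^ ε := by
              rw [← Real.rpow_mul two_pos.le, one_div_mul_cancel hε.ne', Real.rpow_one]
          _ ≤ _ := Real.rpow_le_rpow (by positivity) h3 hε.le
      rw [one_mul]
      calc ((j : ℝ) + 1) ≤ 2 ^ j := by exact_mod_cast (Nat.lt_two_pow_self (n := j))
        _ ≤ _ := by gcongr
  have hcast : ((n : ℕ) : ℝ) ^ ε = ∏ q ∈ primeSupport n, (((q : ℕ) : ℝ) ^ ε) ^ primeExp q n := by
    rw [coe_eq_prod_primeExp (subset_refl (primeSupport n))]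
    push_cast
    rw [← Real.finsetProd_rpow _ _ (fun q _ => by positivity)]
    refine Finset.prod_congr rfl fun q _ => ?_
    rw [← Real.rpow_natCast, ← Real.rpow_natCast, ← Real.rpow_mul (by positivity),
      ← Real.rpow_mul (by positivity), mul_comm]
  rw [divisorCount]
  push_cast
  refine (Finset.prod_le_prod (fun _ _ => by positivity) fun q _ => hfac q _).trans ?_
  rw [Finset.prod_mul_distrib, hcast]
  refine mul_le_mul_of_nonneg_right ?_ (Finset.prod_nonneg fun _ _ => by positivity)
  rw [Finset.prod_ite, Finset.prod_const, Finset.prod_const_one, mul_one]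
  refine pow_le_pow_right₀ hC1 ?_
  calc _ ≤ (Finset.range B).card := Finset.card_le_card_of_injOn (fun q : Nat.Primes => (q : ℕ))
        (fun q hq => by simpa using (Finset.mem_filter.1 hq).2)
        (fun _ _ _ _ h => Subtype.ext h)
    _ = B := Finset.card_range B

/-! ### Homomorphisms bounded by a power of the norm -/

/-- The norms of the completions are powers of the quasi-norms, with exponents depending on the
space, so a bounded map satisfies a bound of this Hölder form only. -/
theorem continuous_of_enorm_le {A B : Type*} [SeminormedAddCommGroup A] [SeminormedAddCommGroup B]
    (f : A →+ B) {C : ℝ≥0∞} (hC : C ≠ ∞) {s : ℝ} (hs : 0 < s)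
    (h : ∀ x, ‖f x‖ₑ ≤ C * ‖x‖ₑ ^ s) : Continuous f := by
  refine continuous_of_continuousAt_zero f ?_
  rw [ContinuousAt, map_zero, tendsto_zero_iff_enorm_tendsto_zero]
  have h1 : Tendsto (fun x : A => C * ‖x‖ₑ ^ s) (𝓝 0) (𝓝 0) := by
    have h2 : Continuous fun x : A => C * ‖x‖ₑ ^ s :=
      (ENNReal.continuous_const_mul hC).comp
        (ENNReal.continuous_rpow_const.comp continuous_enorm)
    simpa [← ofReal_norm, ENNReal.zero_rpow_of_pos hs] using h2.tendsto 0
  exact tendsto_of_tendsto_of_tendsto_of_le_of_le tendsto_const_nhds h1 (fun _ => zero_le) h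

theorem enorm_extension_le {A B : Type*} [SeminormedAddCommGroup A] [NormedAddCommGroup B]
    (f : UniformSpace.Completion A →+ B) (hf : Continuous f) {C : ℝ≥0∞} (hC : C ≠ ∞) {s : ℝ}
    (h : ∀ x : A, ‖f x‖ₑ ≤ C * ‖x‖ₑ ^ s) (F : UniformSpace.Completion A) :
    ‖f F‖ₑ ≤ C * ‖F‖ₑ ^ s := by
  induction F using UniformSpace.Completion.induction_on with
  | hp =>
    exact isClosed_le (continuous_enorm.comp hf) ((ENNReal.continuous_const_mul hC).comp
        (ENNReal.continuous_rpow_const.comp continuous_enorm))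
  | ih x =>
    refine (h x).trans (le_of_eq ?_)
    rw [← ofReal_norm x, ← ofReal_norm (x : UniformSpace.Completion A),
      UniformSpace.Completion.norm_coe]

/-! ### The Hardy space -/

section Hardy

variable {p : ℝ} {hp : 0 < p}

theorem enorm_hardyPoly (P : HardyPoly p hp) : ‖P‖ₑ = hardyPolyNorm p P ^ min 1 p := by
  have h : ‖P‖ = (hardyPolyNorm p P).toReal ^ min 1 p := rfl
  rw [← ofReal_norm, h, ENNReal.toReal_rpow, ENNReal.ofReal_toReal]
  exact ENNReal.rpow_ne_top_of_nonneg (lt_min one_pos hp).le (hardyPolyNorm_ne_top hp P)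

/-- The (quasi-)norm of `ℋ^p` with values in `[0, ∞]`. -/
def hardyENorm (F : HardySpace p hp) : ℝ≥0∞ := ‖F‖ₑ ^ (1 / min 1 p)

theorem ofReal_hardyNorm (F : HardySpace p hp) : ENNReal.ofReal (hardyNorm F) = hardyENorm F := by
  have hr : 0 < min 1 p := lt_min one_pos hp
  rw [hardyNorm, hardyENorm, ← ENNReal.ofReal_rpow_of_nonneg (norm_nonneg _) (by positivity),
    ofReal_norm]

theorem hardyENorm_rpow (F : HardySpace p hp) : hardyENorm F ^ min 1 p = ‖F‖ₑ := by
  have hr : 0 < min 1 p := lt_min one_pos hp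
  rw [hardyENorm, ← ENNReal.rpow_mul, one_div_mul_cancel hr.ne', ENNReal.rpow_one]

theorem hardyENorm_toHardy (P : DirPoly) : hardyENorm (toHardy p hp P) = hardyPolyNorm p P := by
  rw [← ofReal_hardyNorm, hardyNorm_toHardy, ENNReal.ofReal_toReal (hardyPolyNorm_ne_top hp P)]

theorem continuous_hardyENorm : Continuous (hardyENorm : HardySpace p hp → ℝ≥0∞) :=
  ENNReal.continuous_rpow_const.comp continuous_enorm

theorem denseRange_toHardy : DenseRange (toHardy p hp) :=
  UniformSpace.Completion.denseRange_coe (α := HardyPoly p hp)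

theorem toHardy_sub (P Q : DirPoly) : toHardy p hp (P - Q) = toHardy p hp P - toHardy p hp Q :=
  UniformSpace.Completion.coe_sub (α := HardyPoly p hp) P Q

theorem hardy_induction {prop : HardySpace p hp → Prop} (F : HardySpace p hp)
    (hc : IsClosed {F | prop F}) (h : ∀ P, prop (toHardy p hp P)) : prop F :=
  UniformSpace.Completion.induction_on F hc h

theorem exists_helson_exponent (p : ℝ) (hp : 0 < p) : ∃ k : ℕ, 2 / (k + 1 : ℝ) ≤ p := by
  obtain ⟨k, hk⟩ := exists_nat_ge (2 / p)
  refine ⟨k, ?_⟩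
  rw [div_le_iff₀ (by positivity)]
  rw [div_le_iff₀ hp] at hk
  nlinarith

/-- Some `k` with `2 / (k + 1) ≤ p`. -/
def helsonExponent (p : ℝ) (hp : 0 < p) : ℕ := (exists_helson_exponent p hp).choose

theorem sum_sq_coeff_le (P : DirPoly) (T : Finset ℕ+) :
    ∑ n ∈ T, ‖P n‖ₑ ^ 2 / (divisorCount n : ℝ≥0∞) ^ helsonExponent p hp ≤
      hardyPolyNorm p P ^ 2 := by
  classical
  refine le_trans ?_ (sum_sq_div_divisorCount_le (exists_helson_exponent p hp).choose_spec P)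
  rw [← Finset.sum_filter_add_sum_filter_not T (fun n => n ∈ P.support)]
  have h0 : ∑ n ∈ T with n ∉ P.support,
      ‖P n‖ₑ ^ 2 / (divisorCount n : ℝ≥0∞) ^ helsonExponent p hp = 0 :=
    Finset.sum_eq_zero fun n hn => by
      rw [Finsupp.notMem_support_iff.1 (Finset.mem_filter.1 hn).2]; simp
  rw [h0, add_zero]
  exact Finset.sum_le_sum_of_subset fun n hn => (Finset.mem_filter.1 hn).2

theorem enorm_coeff_le (P : DirPoly) (n : ℕ+) : ‖P n‖ₑ ≤
    ((divisorCount n : ℝ≥0∞) ^ helsonExponent p hp) ^ (1 / 2 : ℝ) * hardyPolyNorm p P := by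
  have h := sum_sq_coeff_le (p := p) (hp := hp) P {n}
  have hd : (divisorCount n : ℝ≥0∞) ≠ 0 := by
    exact_mod_cast (divisorCount_pos n).ne'
  rw [Finset.sum_singleton, ENNReal.div_le_iff (pow_ne_zero _ hd) (by finiteness), mul_comm] at h
  have e : ∀ x : ℝ≥0∞, (x ^ 2) ^ (1 / 2 : ℝ) = x := fun x => by
    rw [← ENNReal.rpow_natCast, ← ENNReal.rpow_mul]; norm_num
  have h2 := ENNReal.rpow_le_rpow h (show (0 : ℝ) ≤ 1 / 2 by norm_num)
  rwa [ENNReal.mul_rpow_of_nonneg _ _ (by norm_num), e, e] at h2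

/-- The coefficient of `n^{-s}` of a Dirichlet polynomial. -/
def polyCoeff (n : ℕ+) : HardyPoly p hp →+ ℂ where
  toFun P := (show DirPoly from P) n
  map_zero' := rfl
  map_add' _ _ := rfl

theorem hardyPolyNorm_eq_enorm_rpow (P : HardyPoly p hp) :
    hardyPolyNorm p P = ‖P‖ₑ ^ (1 / min 1 p) := by
  have hr : 0 < min 1 p := lt_min one_pos hp
  rw [enorm_hardyPoly, ← ENNReal.rpow_mul, mul_one_div_cancel hr.ne', ENNReal.rpow_one]

theorem continuous_polyCoeff (n : ℕ+) : Continuous (polyCoeff n : HardyPoly p hp →+ ℂ) := by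
  have hr : 0 < min 1 p := lt_min one_pos hp
  refine continuous_of_enorm_le _
    (C := ((divisorCount n : ℝ≥0∞) ^ helsonExponent p hp) ^ (1 / 2 : ℝ)) (by finiteness)
    (s := 1 / min 1 p) (by positivity) fun P => ?_
  rw [← hardyPolyNorm_eq_enorm_rpow]
  exact enorm_coeff_le P n

/-- The `n`-th coefficient of an element of `ℋ^p`. -/
def hardyCoeff (n : ℕ+) : HardySpace p hp →+ ℂ :=
  (polyCoeff n).extension (continuous_polyCoeff n)

theorem hardyCoeff_toHardy (n : ℕ+) (P : DirPoly) : hardyCoeff n (toHardy p hp P) = P n :=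
  AddMonoidHom.extension_coe _ (continuous_polyCoeff n) _

theorem continuous_hardyCoeff (n : ℕ+) : Continuous (hardyCoeff n : HardySpace p hp →+ ℂ) :=
  AddMonoidHom.continuous_extension _ (continuous_polyCoeff n)

/-- For a finite `T` both sides are continuous in `F`, so the inequality passes from the polynomials
to their completion. -/
theorem sum_sq_hardyCoeff_le (F : HardySpace p hp) (T : Finset ℕ+) :
    ∑ n ∈ T, ‖hardyCoeff n F‖ₑ ^ 2 / (divisorCount n : ℝ≥0∞) ^ helsonExponent p hp ≤
      hardyENorm F ^ 2 := by
  refine hardy_induction (prop := fun F => ∑ n ∈ T, ‖hardyCoeff n F‖ₑ ^ 2 /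
    (divisorCount n : ℝ≥0∞) ^ helsonExponent p hp ≤ hardyENorm F ^ 2) F
    (isClosed_le ?_ ((ENNReal.continuous_pow 2).comp continuous_hardyENorm)) fun P => ?_
  · refine continuous_finsetSum _ fun n _ => ?_
    have h0 : ((divisorCount n : ℝ≥0∞) ^ helsonExponent p hp) ≠ 0 :=
      pow_ne_zero _ (by exact_mod_cast (divisorCount_pos n).ne')
    exact (ENNReal.continuous_div_const _ h0).comp
      ((ENNReal.continuous_pow 2).comp (continuous_enorm.comp (continuous_hardyCoeff n)))
  · simp only [hardyCoeff_toHardy, hardyENorm_toHardy]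
    exact sum_sq_coeff_le P T

/-- Absolute convergence to the right of `1/2`. -/
theorem exists_sum_hardyCoeff_le {σ : ℝ} (hσ : 1 / 2 < σ) :
    ∃ K : ℝ≥0∞, K ≠ ∞ ∧ ∀ (F : HardySpace p hp) (T : Finset ℕ+),
      ∑ n ∈ T, ‖hardyCoeff n F‖ₑ * ENNReal.ofReal (((n : ℕ) : ℝ) ^ (-σ)) ≤ K * hardyENorm F := by
  set k := helsonExponent p hp with hk
  -- With `d(n) ≤ C n^ε` this choice gives `kε < 2σ - 1`, so that `∑ d(n)^k n^{-2σ}` converges.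
  set ε : ℝ := (σ - 1 / 2) / (k + 1) with hε
  have hε0 : 0 < ε := div_pos (by linarith) (by positivity)
  obtain ⟨C, hC1, hC⟩ := exists_divisorCount_le hε0
  have hkε : k * ε < 2 * σ - 1 := by
    rw [hε, mul_div_assoc', div_lt_iff₀ (by positivity)]
    nlinarith [(Nat.cast_nonneg k : (0 : ℝ) ≤ k)]
  have hsum : Summable fun n : ℕ+ => C ^ k * ((n : ℕ) : ℝ) ^ (k * ε - 2 * σ) :=
    ((Real.summable_nat_rpow.2 (by linarith)).comp_injective PNat.coe_injective).mul_left _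
  set L : ℝ≥0∞ := ENNReal.ofReal (∑' n : ℕ+, C ^ k * ((n : ℕ) : ℝ) ^ (k * ε - 2 * σ)) with hL
  refine ⟨L ^ (1 / 2 : ℝ), by finiteness, fun F T => ?_⟩
  have hd0 : ∀ n : ℕ+, (divisorCount n : ℝ≥0∞) ^ k ≠ 0 := fun n =>
    pow_ne_zero _ (by exact_mod_cast (divisorCount_pos n).ne')
  have hdt : ∀ n : ℕ+, (divisorCount n : ℝ≥0∞) ^ k ≠ ∞ := fun n => by finiteness
  set D : ℕ+ → ℝ≥0∞ := fun n => ((divisorCount n : ℝ≥0∞) ^ k) ^ (1 / 2 : ℝ) with hD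
  have hD0 : ∀ n, D n ≠ 0 := fun n => by
    simp only [hD, ne_eq, ENNReal.rpow_eq_zero_iff, hd0 n, hdt n]; norm_num
  have hDt : ∀ n, D n ≠ ∞ := fun n => by
    simp only [hD]; exact ENNReal.rpow_ne_top_of_nonneg (by norm_num) (hdt n)
  have hDD : ∀ n, D n ^ (2 : ℝ) = (divisorCount n : ℝ≥0∞) ^ k := fun n => by
    simp only [hD]; rw [← ENNReal.rpow_mul]; norm_num
  -- Cauchy–Schwarz with the weight `D n = d(n)^{k/2}`: the first factor is Helson's sum, the second
  -- the convergent series.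
  have hCS := ENNReal.inner_le_Lp_mul_Lq T (fun n => ‖hardyCoeff n F‖ₑ / D n)
    (fun n => D n * ENNReal.ofReal (((n : ℕ) : ℝ) ^ (-σ))) Real.HolderConjugate.two_two
  have h1 : ∑ n ∈ T, (‖hardyCoeff n F‖ₑ / D n) ^ (2 : ℝ) ≤ hardyENorm F ^ 2 := by
    refine le_trans (le_of_eq (Finset.sum_congr rfl fun n _ => ?_)) (sum_sq_hardyCoeff_le F T)
    rw [ENNReal.div_rpow_of_nonneg _ _ two_pos.le, hDD, ENNReal.rpow_two]
  have h2 : ∑ n ∈ T, (D n * ENNReal.ofReal (((n : ℕ) : ℝ) ^ (-σ))) ^ (2 : ℝ) ≤ L := by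
    have h3 : ∀ n : ℕ+, (D n * ENNReal.ofReal (((n : ℕ) : ℝ) ^ (-σ))) ^ (2 : ℝ) ≤
        ENNReal.ofReal (C ^ k * ((n : ℕ) : ℝ) ^ (k * ε - 2 * σ)) := fun n => by
      have hn : (0 : ℝ) < (n : ℕ) := by exact_mod_cast n.pos
      rw [ENNReal.mul_rpow_of_nonneg _ _ two_pos.le, hDD,
        ENNReal.ofReal_rpow_of_nonneg (by positivity) two_pos.le, ← ENNReal.ofReal_natCast,
        ← ENNReal.ofReal_pow (by positivity), ← ENNReal.ofReal_mul (by positivity)]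
      refine ENNReal.ofReal_le_ofReal ?_
      calc _ ≤ (C * ((n : ℕ) : ℝ) ^ ε) ^ k * (((n : ℕ) : ℝ) ^ (-σ)) ^ (2 : ℝ) := by
            gcongr; exact hC n
        _ = C ^ k * (((n : ℕ) : ℝ) ^ (k * ε) * ((n : ℕ) : ℝ) ^ (-σ * 2)) := by
            rw [mul_pow, ← Real.rpow_natCast (_ ^ ε), ← Real.rpow_mul hn.le,
              ← Real.rpow_mul hn.le, mul_comm ε, mul_assoc]
        _ = _ := by
            rw [← Real.rpow_add hn]
            congr 2
            ring
    refine (Finset.sum_le_sum fun n _ => h3 n).trans ?_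
    rw [← ENNReal.ofReal_sum_of_nonneg fun n _ => by positivity]
    exact ENNReal.ofReal_le_ofReal (hsum.sum_le_tsum _ fun n _ => by positivity)
  calc ∑ n ∈ T, ‖hardyCoeff n F‖ₑ * ENNReal.ofReal (((n : ℕ) : ℝ) ^ (-σ))
      = ∑ n ∈ T, (‖hardyCoeff n F‖ₑ / D n) * (D n * ENNReal.ofReal (((n : ℕ) : ℝ) ^ (-σ))) :=
        Finset.sum_congr rfl fun n _ => by
          rw [← mul_assoc, ENNReal.div_mul_cancel (hD0 n) (hDt n)]
    _ ≤ _ := hCS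
    _ ≤ (hardyENorm F ^ 2) ^ (1 / 2 : ℝ) * L ^ (1 / 2 : ℝ) := by gcongr
    _ = L ^ (1 / 2 : ℝ) * hardyENorm F := by
        rw [← ENNReal.rpow_natCast, ← ENNReal.rpow_mul, mul_comm]; norm_num

end Hardy

/-! ### Uniqueness of the coefficients of a Dirichlet series -/

/-- The extension by zero of the coefficients to the natural numbers. -/
def natCoeff (a : ℕ+ → ℂ) (n : ℕ) : ℂ := if h : 0 < n then a ⟨n, h⟩ else 0

theorem natCoeff_coe (a : ℕ+ → ℂ) (n : ℕ+) : natCoeff a n = a n := by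
  rw [natCoeff, dif_pos n.pos]
  rfl

theorem partialSum_eq_sum_term (a : ℕ+ → ℂ) (N : ℕ) (s : ℂ) :
    partialSum a N s = ∑ i ∈ Finset.range (N + 1), LSeries.term (natCoeff a) s i := by
  rw [Finset.sum_range_succ', LSeries.term_zero, add_zero]
  refine Finset.sum_congr rfl fun i _ => ?_
  rw [LSeries.term_of_ne_zero (Nat.succ_ne_zero i), Complex.cpow_neg, div_eq_mul_inv]
  congr 1

/-- Convergence at `s = 1` bounds the terms `a_n / n`; then `a_n = O(n)`, and the series converges
absolutely for `Re s > 2`. -/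
theorem abscissaOfAbsConv_natCoeff_le_two {a : ℕ+ → ℂ} {v : ℂ}
    (h : Tendsto (fun N => partialSum a N 1) atTop (𝓝 v)) :
    LSeries.abscissaOfAbsConv (natCoeff a) ≤ 2 := by
  obtain ⟨C, hC⟩ := (Metric.isBounded_range_of_tendsto _ h).exists_norm_le
  have hb : ∀ N, ‖partialSum a N 1‖ ≤ C := fun N => hC _ ⟨N, rfl⟩
  refine (LSeries.abscissaOfAbsConv_le_of_le_const_mul_rpow (x := 1) ⟨2 * C, fun n hn => ?_⟩).trans
    (le_of_eq (by norm_num))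
  obtain ⟨m, rfl⟩ := Nat.exists_eq_succ_of_ne_zero hn
  have h1 : LSeries.term (natCoeff a) 1 (m + 1) = partialSum a (m + 1) 1 - partialSum a m 1 := by
    rw [partialSum_eq_sum_term, partialSum_eq_sum_term, Finset.sum_range_succ _ (m + 1)]
    ring
  have h2 : ‖LSeries.term (natCoeff a) 1 (m + 1)‖ ≤ 2 * C := by
    rw [h1, two_mul]
    exact (norm_sub_le _ _).trans (add_le_add (hb _) (hb _))
  rw [LSeries.term_of_ne_zero (Nat.succ_ne_zero m), Complex.cpow_one, norm_div,
    div_le_iff₀ (by simpa using Nat.cast_add_one_ne_zero m), Complex.norm_natCast] at h2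
  simpa using h2

theorem tendsto_partialSum_LSeries {a : ℕ+ → ℂ} {s : ℂ}
    (h : LSeries.abscissaOfAbsConv (natCoeff a) < s.re) :
    Tendsto (fun N => partialSum a N s) atTop (𝓝 (LSeries (natCoeff a) s)) := by
  simp only [partialSum_eq_sum_term]
  exact ((LSeriesSummable_of_abscissaOfAbsConv_lt_re h).hasSum.tendsto_sum_nat).comp
    (tendsto_add_atTop_nat 1)

/-- Both series converge absolutely to the right of `2` and have equal sums there, so uniqueness for
absolutely convergent L-series applies. -/
theorem coeff_eq_of_tendsto_partialSum {a b : ℕ+ → ℂ} (h : ∀ s ∈ halfPlane (1 / 2), ∃ v : ℂ,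
    Tendsto (fun N => partialSum a N s) atTop (𝓝 v) ∧
    Tendsto (fun N => partialSum b N s) atTop (𝓝 v)) : a = b := by
  obtain ⟨v, hva, hvb⟩ := h 1 (by simp [halfPlane]; norm_num)
  have ha := abscissaOfAbsConv_natCoeff_le_two hva
  have hb := abscissaOfAbsConv_natCoeff_le_two hvb
  have h2 : (2 : EReal) < ⊤ := EReal.coe_lt_top 2
  funext n
  rw [← natCoeff_coe a, ← natCoeff_coe b]
  refine LSeries.eq_of_LSeries_eventually_eq (ha.trans_lt h2) (hb.trans_lt h2) ?_ n.ne_zero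
  filter_upwards [eventually_gt_atTop (2 : ℝ)] with x hx
  obtain ⟨w, hwa, hwb⟩ := h x (by simp only [halfPlane, Set.mem_ofPred_eq, Complex.ofReal_re]; linarith)
  have hx' : (2 : EReal) < ((x : ℂ).re : EReal) := by
    rw [Complex.ofReal_re]; exact EReal.coe_lt_coe_iff.2 hx
  rw [tendsto_nhds_unique (tendsto_partialSum_LSeries (ha.trans_lt hx')) hwa,
    tendsto_nhds_unique (tendsto_partialSum_LSeries (hb.trans_lt hx')) hwb]

/-! ### Completions with bounded coefficient functionals -/

/-- Coefficient functionals `c n` on a space `X` that contains the Dirichlet polynomials as a dense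
subset, with absolute convergence to the right of `1/2`. -/
structure CoeffSystem {X : Type*} [NormedAddCommGroup X] (ι : DirPoly → X)
    (c : ℕ+ → X →+ ℂ) : Prop where
  dense : DenseRange ι
  coeff : ∀ n P, c n (ι P) = P n
  -- The exponent `r` allows for `‖F‖` being a power of the quasi-norm.
  bound : ∀ σ : ℝ, 1 / 2 < σ → ∃ (K : ℝ≥0∞) (r : ℝ), K ≠ ∞ ∧ 0 < r ∧
    ∀ (F : X) (T : Finset ℕ+),
      ∑ n ∈ T, ‖c n F‖ₑ * ENNReal.ofReal (((n : ℕ) : ℝ) ^ (-σ)) ≤ K * ‖F‖ₑ ^ r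

namespace CoeffSystem

variable {X : Type*} [NormedAddCommGroup X] {ι : DirPoly → X} {c : ℕ+ → X →+ ℂ}

theorem tsum_le (h : CoeffSystem ι c) {σ : ℝ} (hσ : 1 / 2 < σ) :
    ∃ (K : ℝ≥0∞) (r : ℝ), K ≠ ∞ ∧ 0 < r ∧ ∀ F : X,
      ∑' n : ℕ+, ‖c n F‖ₑ * ENNReal.ofReal (((n : ℕ) : ℝ) ^ (-σ)) ≤ K * ‖F‖ₑ ^ r := by
  obtain ⟨K, r, hK, hr, hb⟩ := h.bound σ hσ
  refine ⟨K, r, hK, hr, fun F => ?_⟩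
  rw [ENNReal.tsum_eq_iSup_sum]
  exact iSup_le (hb F)

theorem enorm_term (b : ℂ) (n : ℕ+) (s : ℂ) : ‖b * ((n : ℕ) : ℂ) ^ (-s)‖ₑ =
    ‖b‖ₑ * ENNReal.ofReal (((n : ℕ) : ℝ) ^ (-s.re)) := by
  rw [enorm_mul, ← ofReal_norm (_ ^ _), Complex.norm_natCast_cpow_of_pos n.pos, Complex.neg_re]

theorem summable_norm (h : CoeffSystem ι c) (F : X) {s : ℂ} (hs : 1 / 2 < s.re) :
    Summable fun n : ℕ+ => ‖c n F * ((n : ℕ) : ℂ) ^ (-s)‖ := by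
  obtain ⟨K, r, hK, hr, hb⟩ := h.tsum_le hs
  rw [← tsum_enorm_ne_top_iff_summable_norm]
  simp only [enorm_term]
  exact ne_top_of_le_ne_top (by finiteness) (hb F)

/-- The sum of the series of `F` at `s`. -/
def value (c : ℕ+ → X →+ ℂ) (F : X) (s : ℂ) : ℂ := ∑' n : ℕ+, c n F * ((n : ℕ) : ℂ) ^ (-s)

theorem tendsto_partialSum (h : CoeffSystem ι c) (F : X) {s : ℂ} (hs : 1 / 2 < s.re) :
    Tendsto (fun N => partialSum (fun n => c n F) N s) atTop (𝓝 (value c F s)) :=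
  ((Equiv.pnatEquivNat.symm.hasSum_iff).2 (h.summable_norm F hs).of_norm.hasSum).tendsto_sum_nat

/-- Weierstrass' M-test: the terms are dominated by their absolute values at `1/2 + ε`. -/
theorem tendstoUniformlyOn (h : CoeffSystem ι c) (F : X) {ε : ℝ} (hε : 0 < ε) :
    TendstoUniformlyOn (fun N s => partialSum (fun n => c n F) N s) (value c F) atTop
      (halfPlane (1 / 2 + ε)) := by
  have hs : (1 : ℝ) / 2 < ((1 / 2 + ε : ℝ) : ℂ).re := by rw [Complex.ofReal_re]; linarith
  have hsum := (Equiv.pnatEquivNat.symm.summable_iff).2 (h.summable_norm F hs)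
  have e : ∀ s, value c F s =
      ∑' i : ℕ, c i.succPNat F * ((i.succPNat : ℕ) : ℂ) ^ (-s) := fun s =>
    (Equiv.pnatEquivNat.symm.tsum_eq fun n : ℕ+ => c n F * ((n : ℕ) : ℂ) ^ (-s)).symm
  rw [funext e]
  refine tendstoUniformlyOn_tsum_nat hsum fun i s hs' => ?_
  simp only [Function.comp, Equiv.pnatEquivNat_symm_apply, norm_mul]
  refine mul_le_mul_of_nonneg_left ?_ (norm_nonneg _)
  rw [Complex.norm_natCast_cpow_of_pos i.succPNat.pos, Complex.norm_natCast_cpow_of_pos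
    i.succPNat.pos, Complex.neg_re, Complex.neg_re, Complex.ofReal_re]
  exact Real.rpow_le_rpow_of_exponent_le (by exact_mod_cast i.succPNat.pos) (neg_le_neg hs'.le)

theorem polyEval_eq_value (h : CoeffSystem ι c) (P : DirPoly) (s : ℂ) :
    polyEval P s = value c (ι P) s := by
  rw [value, tsum_eq_sum (s := P.support) fun n hn => by
    rw [h.coeff, Finsupp.notMem_support_iff.1 hn, zero_mul]]
  exact Finset.sum_congr rfl fun n _ => by rw [h.coeff]

/-- The value is additive in `F`, so the difference of two values is at most `K ‖G - F‖^r`. -/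
theorem tendsto_value (h : CoeffSystem ι c) (F : X) {s : ℂ} (hs : 1 / 2 < s.re) :
    Tendsto (fun G => value c G s) (𝓝 F) (𝓝 (value c F s)) := by
  obtain ⟨K, r, hK, hr, hb⟩ := h.tsum_le hs
  rw [tendsto_iff_enorm_sub_tendsto_zero]
  have h1 : Tendsto (fun G : X => K * ‖G - F‖ₑ ^ r) (𝓝 F) (𝓝 0) := by
    have h2 : Continuous fun G : X => K * ‖G - F‖ₑ ^ r :=
      (ENNReal.continuous_const_mul hK).comp
        (ENNReal.continuous_rpow_const.comp (continuous_enorm.comp (continuous_id.sub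
          continuous_const)))
    simpa [hr] using h2.tendsto F
  refine tendsto_of_tendsto_of_tendsto_of_le_of_le tendsto_const_nhds h1 (fun _ => zero_le)
    fun G => ?_
  rw [value, value, ← ((h.summable_norm G hs).of_norm).tsum_sub ((h.summable_norm F hs).of_norm)]
  refine (enorm_tsum_le_tsum_enorm).trans (le_trans (le_of_eq (tsum_congr fun n => ?_)) (hb (G - F)))
  rw [← sub_mul, ← map_sub, enorm_term]

theorem isSeriesOf (h : CoeffSystem ι c) (F : X) : IsSeriesOf ι F fun n => c n F := fun s hs => by
  refine ⟨value c F s, ?_, h.tendsto_partialSum F hs⟩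
  simp only [h.polyEval_eq_value]
  exact (h.tendsto_value F hs).comp tendsto_comap

theorem eq_coeff_of_isSeriesOf (h : CoeffSystem ι c) {F : X} {b : ℕ+ → ℂ}
    (hb : IsSeriesOf ι F b) : b = fun n => c n F := by
  -- Density makes the limit of `P(s)` as `P → F` unique, so the two series have the same sum at
  -- every `s`.
  have hne : (comap ι (𝓝 F)).NeBot := by
    rw [comap_neBot_iff_frequently]
    exact mem_closure_iff_frequently.1 (h.dense F)
  refine coeff_eq_of_tendsto_partialSum fun s hs => ?_
  obtain ⟨v, hv, hvb⟩ := hb s hs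
  obtain ⟨w, hw, hwa⟩ := h.isSeriesOf F s hs
  exact ⟨v, hvb, tendsto_nhds_unique hw hv ▸ hwa⟩

end CoeffSystem

/-- The coefficient functionals of `ℋ^p`. -/
theorem coeffSystem_hardy (p : ℝ) (hp : 0 < p) :
    CoeffSystem (toHardy p hp) fun n => hardyCoeff n where
  dense := denseRange_toHardy
  coeff := hardyCoeff_toHardy
  bound σ hσ := by
    obtain ⟨K, hK, hb⟩ := exists_sum_hardyCoeff_le (p := p) (hp := hp) hσ
    have hr : 0 < min 1 p := lt_min one_pos hp
    exact ⟨K, 1 / min 1 p, hK, by positivity, hb⟩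

/-! ### Parseval's identity on the infinite torus -/

theorem lintegral_sq_eval (f : Polynomial ℂ) :
    ∫⁻ t : UnitAddCircle, ‖f.eval ((AddCircle.toCircle t : Circle) : ℂ)‖ₑ ^ 2
      ∂AddCircle.haarAddCircle = ∑' n, ‖f.coeff n‖ₑ ^ 2 :=
  (tsum_sq_taylor (G := fun z => f.eval z) f.differentiable.diffContOnCl
    (hasTaylor_polynomial f)).symm

/-- The induction behind Helson's inequality, with Parseval's identity on the slices in place of
Carleman's inequality; every step is an equality. -/
theorem lintegral_sq_bohrLift_of_support (S : Finset Nat.Primes) (P : DirPoly)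
    (hP : ∀ n ∈ P.support, ∀ n' ∈ P.support, ∀ q ∉ S, primeExp q n = primeExp q n') :
    ∫⁻ x, ‖bohrLift P x‖ₑ ^ 2 ∂torusMeasure = ∑ n ∈ P.support, ‖P n‖ₑ ^ 2 := by
  classical
  induction S using Finset.induction_on generalizing P with
  | empty =>
    rcases P.support.eq_empty_or_nonempty with h0 | ⟨n, hn⟩
    · simp [Finsupp.support_eq_empty.1 h0, bohrLift]
    have hs : P.support = {n} := Finset.eq_singleton_iff_unique_mem.2
      ⟨hn, fun n' hn' => eq_of_primeExp_eq fun q => hP n' hn' n hn q (Finset.notMem_empty q)⟩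
    have h1 : ∀ x, ‖bohrLift P x‖ₑ = ‖P n‖ₑ := fun x => by
      have h2 : ‖monomial n x‖ₑ = 1 := by rw [← ofReal_norm, norm_monomial]; simp
      rw [bohrLift, Finsupp.sum, hs, Finset.sum_singleton, enorm_mul, h2, mul_one]
    simp [h1, hs]
  | insert q S hq ih =>
    obtain ⟨N, hN⟩ : ∃ N, ∀ n ∈ P.support, primeExp q n ∈ Finset.range N :=
      ⟨P.support.sup (primeExp q) + 1, fun n hn =>
        Finset.mem_range.2 (Nat.lt_succ_of_le (Finset.le_sup (f := primeExp q) hn))⟩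
    have hpart : ∀ j, ∫⁻ x, ‖bohrLift (expPart P q j) x‖ₑ ^ 2 ∂torusMeasure =
        ∑ n ∈ P.support with primeExp q n = j, ‖P n‖ₑ ^ 2 := fun j => by
      rw [ih (expPart P q j) fun n hn n' hn' q' hq' => by
        rw [expPart, Finsupp.support_filter, Finset.mem_filter] at hn hn'
        by_cases h : q' = q
        · rw [h, hn.2, hn'.2]
        · exact hP n hn.1 n' hn'.1 q' (by simp [h, hq'])]
      rw [expPart, Finsupp.support_filter]
      refine Finset.sum_congr rfl fun n hn => ?_
      rw [Finsupp.filter_apply_pos (fun n => primeExp q n = j) P (Finset.mem_filter.1 hn).2]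
    have hzero : ∀ x, ∀ j ∉ Finset.range N, ‖(slice P q x).coeff j‖ₑ ^ 2 = 0 := fun x j hj => by
      have h0 : expPart P q j = 0 := by
        rw [expPart, Finsupp.filter_eq_zero_iff]
        intro n hn
        by_contra h
        exact hj (hn ▸ hN n (Finsupp.mem_support_iff.2 h))
      simp [coeff_slice, h0, bohrLift]
    rw [← Finset.sum_fiberwise_of_maps_to hN,
      lintegral_torusMeasure_eq q ((measurable_bohrLift _).enorm.pow_const _)]
    simp only [bohrLift_add_single, lintegral_sq_eval]
    rw [lintegral_congr fun x => tsum_eq_sum (hzero x)]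
    simp only [coeff_slice]
    rw [lintegral_finsetSum _ fun j _ => (measurable_bohrLift _).enorm.pow_const _]
    exact Finset.sum_congr rfl fun j _ => hpart j

theorem lintegral_sq_bohrLift (P : DirPoly) :
    ∫⁻ x, ‖bohrLift P x‖ₑ ^ 2 ∂torusMeasure = ∑ n ∈ P.support, ‖P n‖ₑ ^ 2 := by
  classical
  refine lintegral_sq_bohrLift_of_support (P.support.biUnion primeSupport) P
    fun n hn n' hn' q hq => ?_
  rw [Finset.mem_biUnion] at hq
  push Not at hq
  rw [primeExp_eq_zero (hq n hn), primeExp_eq_zero (hq n' hn')]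

/-- Lower semicontinuity of the norm of `ℋ^p` with respect to the convergence in `ℋ^2`. -/
theorem hardyPolyNorm_le_of_tendsto {p : ℝ} (hp : 0 < p) {Q : DirPoly} {R : ℕ → DirPoly}
    (hR : Tendsto (fun k => ∫⁻ x, ‖bohrLift (R k) x‖ₑ ^ 2 ∂torusMeasure) atTop (𝓝 0)) {M : ℝ≥0∞}
    (hM : ∀ᶠ k in atTop, hardyPolyNorm p (Q - R k) ≤ M) : hardyPolyNorm p Q ≤ M := by
  have h1 : Tendsto (fun k => eLpNorm (bohrLift (R k) - 0) 2 torusMeasure) atTop (𝓝 0) := by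
    have h2 := (ENNReal.continuous_rpow_const (y := 1 / 2)).tendsto (0 : ℝ≥0∞) |>.comp hR
    rw [ENNReal.zero_rpow_of_pos (by norm_num)] at h2
    refine h2.congr fun k => ?_
    rw [sub_zero, eLpNorm_eq_lintegral_rpow_enorm_toReal two_ne_zero ENNReal.ofNat_ne_top]
    simp
  -- Convergence in `L²` gives almost everywhere convergence along a subsequence; Fatou's lemma then
  -- works for every `p > 0`.
  obtain ⟨ns, hns, hae⟩ := (tendstoInMeasure_of_tendsto_eLpNorm two_ne_zero
    (fun k => (measurable_bohrLift (R k)).aestronglyMeasurable)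
    aestronglyMeasurable_zero h1).exists_seq_tendsto_ae
  have hsub : ∀ k x, bohrLift (Q - R k) x = bohrLift Q x - bohrLift (R k) x := fun k x => by
    rw [sub_eq_add_neg, bohrLift_add, bohrLift_neg, ← sub_eq_add_neg]
  have hle : ∫⁻ x, ‖bohrLift Q x‖ₑ ^ p ∂torusMeasure ≤ M ^ p := by
    calc _ = ∫⁻ x, liminf (fun i => ‖bohrLift (Q - R (ns i)) x‖ₑ ^ p) atTop ∂torusMeasure := by
          refine lintegral_congr_ae ?_
          filter_upwards [hae] with x hx
          have h3 : Tendsto (fun i => ‖bohrLift (Q - R (ns i)) x‖ₑ ^ p) atTop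
              (𝓝 (‖bohrLift Q x - 0‖ₑ ^ p)) := by
            simp only [hsub]
            exact (ENNReal.continuous_rpow_const.tendsto _).comp
              ((continuous_enorm.tendsto _).comp (tendsto_const_nhds.sub hx))
          rw [h3.liminf_eq, sub_zero]
      _ ≤ liminf (fun i => ∫⁻ x, ‖bohrLift (Q - R (ns i)) x‖ₑ ^ p ∂torusMeasure) atTop :=
          lintegral_liminf_le fun i => (measurable_bohrLift _).enorm.pow_const _
      _ ≤ M ^ p := by
          refine liminf_le_of_frequently_le' (Eventually.frequently ?_)
          filter_upwards [hns.tendsto_atTop.eventually hM] with i hi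
          have := ENNReal.rpow_le_rpow hi hp.le
          rwa [hardyPolyNorm, ← ENNReal.rpow_mul, one_div_mul_cancel hp.ne',
            ENNReal.rpow_one] at this
  calc hardyPolyNorm p Q ≤ (M ^ p) ^ (1 / p) := ENNReal.rpow_le_rpow hle (by positivity)
    _ = M := by rw [← ENNReal.rpow_mul, mul_one_div_cancel hp.ne', ENNReal.rpow_one]

/-! ### Translations of the Hardy space -/

section Hardy

variable {p : ℝ} {hp : 0 < p}

theorem translatePoly_apply (σ : ℝ) (P : DirPoly) (n : ℕ+) :
    translatePoly σ P n = P n * ((n : ℕ) : ℂ) ^ (-(σ : ℂ)) := rfl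

theorem translatePoly_zero_right (σ : ℝ) : translatePoly σ 0 = 0 := by
  ext n; simp [translatePoly_apply]

theorem translatePoly_sub (σ : ℝ) (P Q : DirPoly) :
    translatePoly σ (P - Q) = translatePoly σ P - translatePoly σ Q := by
  rw [sub_eq_add_neg, translatePoly_add, translatePoly_neg, ← sub_eq_add_neg]

theorem translatePoly_translatePoly (σ τ : ℝ) (P : DirPoly) :
    translatePoly σ (translatePoly τ P) = translatePoly (τ + σ) P := by
  ext n
  have hn : ((n : ℕ) : ℂ) ≠ 0 := by exact_mod_cast n.ne_zero
  simp only [translatePoly_apply]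
  push_cast
  rw [mul_assoc, ← Complex.cpow_add _ _ hn]
  congr 2
  ring

theorem enorm_toHardy (P : DirPoly) : ‖toHardy p hp P‖ₑ = hardyPolyNorm p P ^ min 1 p := by
  rw [← hardyENorm_rpow, hardyENorm_toHardy]

/-- The translation by `σ` on the Dirichlet polynomials. -/
def polyTranslate (σ : ℝ) : HardyPoly p hp →+ HardyPoly p hp where
  toFun P := translatePoly σ P
  map_zero' := translatePoly_zero_right σ
  map_add' := translatePoly_add σ

theorem enorm_polyTranslate_le (σ : ℝ≥0) (P : HardyPoly p hp) : ‖polyTranslate σ P‖ₑ ≤ ‖P‖ₑ := by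
  rw [enorm_hardyPoly, enorm_hardyPoly]
  exact ENNReal.rpow_le_rpow (hardyPolyNorm_translatePoly_le_self hp σ.2 P)
    (lt_min one_pos hp).le

theorem continuous_polyTranslate (σ : ℝ≥0) :
    Continuous (polyTranslate σ : HardyPoly p hp →+ HardyPoly p hp) :=
  continuous_of_enorm_le _ ENNReal.one_ne_top one_pos fun P => by
    simpa using enorm_polyTranslate_le σ P

/-- The translation `F ↦ F_σ` of `ℋ^p`. -/
def hardyTranslate (σ : ℝ≥0) : HardySpace p hp →+ HardySpace p hp :=
  (polyTranslate σ).completion (continuous_polyTranslate σ)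

theorem continuous_hardyTranslate (σ : ℝ≥0) :
    Continuous (hardyTranslate σ : HardySpace p hp →+ HardySpace p hp) :=
  AddMonoidHom.continuous_completion _ (continuous_polyTranslate σ)

theorem hardyTranslate_toHardy (σ : ℝ≥0) (P : DirPoly) :
    hardyTranslate σ (toHardy p hp P) = toHardy p hp (translatePoly σ P) :=
  AddMonoidHom.completion_coe _ (continuous_polyTranslate σ) _

theorem enorm_hardyTranslate_le (σ : ℝ≥0) (F : HardySpace p hp) :
    ‖hardyTranslate σ F‖ₑ ≤ ‖F‖ₑ :=
  hardy_induction (prop := fun F => ‖hardyTranslate σ F‖ₑ ≤ ‖F‖ₑ) F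
    (isClosed_le (continuous_enorm.comp (continuous_hardyTranslate σ)) continuous_enorm) fun P => by
      rw [hardyTranslate_toHardy, enorm_toHardy, enorm_toHardy]
      exact ENNReal.rpow_le_rpow (hardyPolyNorm_translatePoly_le_self hp σ.2 P)
        (lt_min one_pos hp).le

theorem hardyCoeff_hardyTranslate (σ : ℝ≥0) (F : HardySpace p hp) (n : ℕ+) :
    hardyCoeff n (hardyTranslate σ F) = hardyCoeff n F * ((n : ℕ) : ℂ) ^ (-((σ : ℝ) : ℂ)) :=
  hardy_induction (prop := fun F => hardyCoeff n (hardyTranslate σ F) =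
      hardyCoeff n F * ((n : ℕ) : ℂ) ^ (-((σ : ℝ) : ℂ))) F
    (isClosed_eq ((continuous_hardyCoeff n).comp (continuous_hardyTranslate σ))
      ((continuous_hardyCoeff n).mul continuous_const)) fun P => by
    rw [hardyTranslate_toHardy, hardyCoeff_toHardy, hardyCoeff_toHardy, translatePoly_apply]

theorem tendsto_hardyPolyNorm_translatePoly_sub (p : ℝ) (hp : 0 < p) (P : DirPoly) :
    Tendsto (fun σ : ℝ≥0 => hardyPolyNorm p (translatePoly σ P - P)) (𝓝 0) (𝓝 0) := by
  have h1 : ∀ σ : ℝ≥0, hardyPolyNorm p (translatePoly σ P - P) ≤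
      ∑ n ∈ P.support, ‖P n * ((n : ℕ) : ℂ) ^ (-((σ : ℝ) : ℂ)) - P n‖ₑ := fun σ => by
    refine (hardyPolyNorm_le hp _).trans (Finset.sum_le_sum_of_subset fun n hn => ?_)
    rw [Finsupp.mem_support_iff] at hn ⊢
    rintro h
    exact hn (by simp [translatePoly_apply, h])
  have h2 : Continuous fun σ : ℝ≥0 =>
      ∑ n ∈ P.support, ‖P n * ((n : ℕ) : ℂ) ^ (-((σ : ℝ) : ℂ)) - P n‖ₑ := by
    refine continuous_finsetSum _ fun n _ => continuous_enorm.comp ?_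
    refine (continuous_const.mul ?_).sub continuous_const
    exact Continuous.const_cpow (by fun_prop) (Or.inl (by exact_mod_cast n.ne_zero))
  refine tendsto_of_tendsto_of_tendsto_of_le_of_le tendsto_const_nhds ?_ (fun _ => zero_le) h1
  simpa using h2.tendsto 0

/-- The convergence is elementary on polynomials and extends by density because the translations are
uniformly bounded. -/
theorem tendsto_hardyTranslate (F : HardySpace p hp) :
    Tendsto (fun σ : ℝ≥0 => hardyTranslate σ F) (𝓝 0) (𝓝 F) := by
  rw [Metric.tendsto_nhds]
  intro ε hε
  obtain ⟨P, hP⟩ := denseRange_toHardy.exists_dist_lt F (show 0 < ε / 3 by positivity)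
  have hr : 0 < min 1 p := lt_min one_pos hp
  have h1 : Tendsto (fun σ : ℝ≥0 => ‖toHardy p hp (translatePoly σ P) - toHardy p hp P‖ₑ) (𝓝 0)
      (𝓝 0) := by
    simp only [← toHardy_sub, enorm_toHardy]
    have := (ENNReal.continuous_rpow_const (y := min 1 p)).tendsto (0 : ℝ≥0∞) |>.comp
      (tendsto_hardyPolyNorm_translatePoly_sub p hp P)
    rwa [ENNReal.zero_rpow_of_pos hr] at this
  rw [← tendsto_iff_enorm_sub_tendsto_zero] at h1
  filter_upwards [Metric.tendsto_nhds.1 h1 (ε / 3) (by positivity)] with σ hσ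
  have h2 : dist (hardyTranslate σ F) (toHardy p hp (translatePoly σ P)) ≤ dist F (toHardy p hp P) := by
    rw [← hardyTranslate_toHardy, dist_eq_norm, dist_eq_norm, ← map_sub]
    have := enorm_hardyTranslate_le σ (F - toHardy p hp P)
    rwa [enorm_le_iff_norm_le] at this
  calc dist (hardyTranslate σ F) F
      ≤ dist (hardyTranslate σ F) (toHardy p hp (translatePoly σ P)) +
        dist (toHardy p hp (translatePoly σ P)) (toHardy p hp P) + dist (toHardy p hp P) F :=
        dist_triangle4 _ _ _ _
    _ < ε := by rw [dist_comm (toHardy p hp P) F]; linarith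

theorem exists_seq_toHardy (F : HardySpace p hp) :
    ∃ R : ℕ → DirPoly, Tendsto (fun k => toHardy p hp (R k)) atTop (𝓝 F) := by
  obtain ⟨u, hu, hlim⟩ := mem_closure_iff_seq_limit.1 (denseRange_toHardy F)
  choose R hR using hu
  exact ⟨R, by simpa only [hR] using hlim⟩

/-- A translation by `δ > 0` absorbs Helson's weight: `n^{-2δ} d(n)^k` is bounded by the divisor
bound with exponent `2δ/(k+1)`. -/
theorem exists_divisorCount_pow_le (k : ℕ) {δ : ℝ} (hδ : 0 < δ) :
    ∃ K : ℝ≥0∞, K ≠ ∞ ∧ ∀ n : ℕ+,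
      ‖((n : ℕ) : ℂ) ^ (-(δ : ℂ))‖ₑ ^ 2 * (divisorCount n : ℝ≥0∞) ^ k ≤ K := by
  obtain ⟨C, hC1, hC⟩ := exists_divisorCount_le (show 0 < 2 * δ / (k + 1) by positivity)
  refine ⟨ENNReal.ofReal (C ^ k), ENNReal.ofReal_ne_top, fun n => ?_⟩
  have hn : (1 : ℝ) ≤ (n : ℕ) := by exact_mod_cast n.pos
  have hn0 : (0 : ℝ) < (n : ℕ) := one_pos.trans_le hn
  rw [← ofReal_norm, Complex.norm_natCast_cpow_of_pos n.pos, Complex.neg_re, Complex.ofReal_re,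
    ← ENNReal.ofReal_pow (by positivity), ← ENNReal.ofReal_natCast, ← ENNReal.ofReal_pow
    (by positivity), ← ENNReal.ofReal_mul (by positivity)]
  refine ENNReal.ofReal_le_ofReal ?_
  calc (((n : ℕ) : ℝ) ^ (-δ)) ^ 2 * (divisorCount n : ℝ) ^ k
      ≤ (((n : ℕ) : ℝ) ^ (-δ)) ^ 2 * (C * ((n : ℕ) : ℝ) ^ (2 * δ / (k + 1))) ^ k := by
        gcongr; exact hC n
    _ = C ^ k * (((n : ℕ) : ℝ) ^ (-δ * 2) * ((n : ℕ) : ℝ) ^ (2 * δ / (k + 1) * k)) := by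
        rw [mul_pow, ← Real.rpow_natCast (_ ^ (-δ)), ← Real.rpow_natCast (_ ^ (2 * δ / _)),
          ← Real.rpow_mul hn0.le, ← Real.rpow_mul hn0.le]
        push_cast
        ring
    _ ≤ C ^ k * 1 := by
        rw [← Real.rpow_add hn0]
        refine mul_le_mul_of_nonneg_left (Real.rpow_le_one_of_one_le_of_nonpos hn ?_) (by positivity)
        have : 2 * δ / (k + 1) * k ≤ 2 * δ := by
          rw [div_mul_eq_mul_div, div_le_iff₀ (by positivity)]
          nlinarith
        linarith
    _ = C ^ k := mul_one _

/-- An element of `ℋ^p` is determined by its coefficients. -/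
theorem eq_zero_of_hardyCoeff_eq_zero {F : HardySpace p hp} (hF : ∀ n, hardyCoeff n F = 0) :
    F = 0 := by
  have hr : 0 < min 1 p := lt_min one_pos hp
  have key : ∀ δ : ℝ≥0, 0 < δ → hardyTranslate δ F = 0 := by
    intro δ hδ
    obtain ⟨R, hR⟩ := exists_seq_toHardy F
    obtain ⟨K, hK, hKb⟩ := exists_divisorCount_pow_le (helsonExponent p hp)
      (show (0 : ℝ) < δ by exact_mod_cast hδ)
    -- As `F` has zero coefficients, those of `R k` are the coefficients of `R k - F`; Helson's
    -- inequality with the weight absorbed bounds the `L²` norm of `(R k)_δ` by `‖R k - F‖`.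
    have hL2 : Tendsto (fun k => ∫⁻ x, ‖bohrLift (translatePoly δ (R k)) x‖ₑ ^ 2 ∂torusMeasure)
        atTop (𝓝 0) := by
      have h1 : ∀ k, ∫⁻ x, ‖bohrLift (translatePoly δ (R k)) x‖ₑ ^ 2 ∂torusMeasure ≤
          K * hardyENorm (toHardy p hp (R k) - F) ^ 2 := fun k => by
        rw [lintegral_sq_bohrLift]
        refine le_trans ?_ (mul_le_mul_right (sum_sq_hardyCoeff_le
          (toHardy p hp (R k) - F) (translatePoly δ (R k)).support) K)
        rw [Finset.mul_sum]
        refine Finset.sum_le_sum fun n _ => ?_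
        have hd : (divisorCount n : ℝ≥0∞) ^ helsonExponent p hp ≠ 0 :=
          pow_ne_zero _ (by exact_mod_cast (divisorCount_pos n).ne')
        rw [map_sub, hF n, sub_zero, hardyCoeff_toHardy, translatePoly_apply, enorm_mul, mul_pow,
          ← mul_div_assoc, ENNReal.le_div_iff_mul_le (Or.inl hd) (Or.inl (by finiteness)), mul_assoc,
          mul_comm K]
        exact mul_le_mul_right (hKb n) _
      have h2 : Tendsto (fun k => K * hardyENorm (toHardy p hp (R k) - F) ^ 2) atTop (𝓝 0) := by
        have h3 : Continuous fun G : HardySpace p hp => K * hardyENorm (G - F) ^ 2 :=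
          (ENNReal.continuous_const_mul hK).comp ((ENNReal.continuous_pow 2).comp
            (continuous_hardyENorm.comp (continuous_id.sub continuous_const)))
        have h4 := (h3.tendsto F).comp hR
        rw [sub_self, hardyENorm, enorm_zero, ENNReal.zero_rpow_of_pos (by positivity),
          zero_pow two_ne_zero, mul_zero] at h4
        exact h4
      exact tendsto_of_tendsto_of_tendsto_of_le_of_le tendsto_const_nhds h2 (fun _ => zero_le) h1
    have hT : Tendsto (fun l => hardyTranslate δ (toHardy p hp (R l))) atTop
        (𝓝 (hardyTranslate δ F)) := ((continuous_hardyTranslate δ).tendsto F).comp hR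
    refine tendsto_nhds_unique hT ?_
    rw [Metric.tendsto_atTop]
    intro ε hε
    obtain ⟨N, hN⟩ := Metric.cauchySeq_iff.1 hR.cauchySeq (ε / 2) (by positivity)
    refine ⟨N, fun l hl => lt_of_le_of_lt ?_ (half_lt_self hε)⟩
    rw [hardyTranslate_toHardy, dist_zero_right, ← ENNReal.ofReal_le_ofReal_iff (by positivity),
      ofReal_norm, enorm_toHardy]
    -- For fixed `l`, the differences `(R l)_δ - (R k)_δ` are small by the Cauchy property while `(R
    -- k)_δ → 0` in `L²`; lower semicontinuity bounds `(R l)_δ` itself.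
    have h5 : hardyPolyNorm p (translatePoly δ (R l)) ≤
        ENNReal.ofReal (ε / 2) ^ (1 / min 1 p) := by
      refine hardyPolyNorm_le_of_tendsto hp hL2 ?_
      filter_upwards [eventually_ge_atTop N] with k hk
      rw [← translatePoly_sub]
      refine (hardyPolyNorm_translatePoly_le_self hp δ.2 _).trans ?_
      rw [← hardyENorm_toHardy (hp := hp), hardyENorm, toHardy_sub]
      refine ENNReal.rpow_le_rpow ?_ (by positivity)
      rw [← ofReal_norm, ← dist_eq_norm]
      exact ENNReal.ofReal_le_ofReal (hN l hl k hk).le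
    refine (ENNReal.rpow_le_rpow h5 hr.le).trans (le_of_eq ?_)
    rw [← ENNReal.rpow_mul, one_div_mul_cancel hr.ne', ENNReal.rpow_one]
  have h1 : Tendsto (fun k : ℕ => hardyTranslate (1 / ((k : ℝ≥0) + 1)) F) atTop (𝓝 F) :=
    (tendsto_hardyTranslate F).comp tendsto_one_div_add_atTop_nhds_zero_nat
  refine tendsto_nhds_unique h1 (tendsto_const_nhds.congr fun k => (key _ (by positivity)).symm)

theorem hardy_ext {F G : HardySpace p hp} (h : ∀ n, hardyCoeff n F = hardyCoeff n G) : F = G :=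
  sub_eq_zero.1 (eq_zero_of_hardyCoeff_eq_zero fun n => by rw [map_sub, h, sub_self])

theorem isSeriesOf_hardy_iff {F : HardySpace p hp} {a : ℕ+ → ℂ} :
    IsSeriesOf (toHardy p hp) F a ↔ ∀ n, hardyCoeff n F = a n := by
  constructor
  · intro h n
    rw [(coeffSystem_hardy p hp).eq_coeff_of_isSeriesOf h]
  · intro h
    rw [← funext h]
    exact (coeffSystem_hardy p hp).isSeriesOf F

/-- By uniqueness the infimum runs over a single element. -/
theorem seriesHardyNorm_eq {F : HardySpace p hp} {a : ℕ+ → ℂ} (h : ∀ n, hardyCoeff n F = a n) :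
    seriesHardyNorm p hp a = hardyENorm F := by
  refine le_antisymm ?_ ?_
  · rw [← ofReal_hardyNorm]
    exact iInf₂_le F (isSeriesOf_hardy_iff.2 h)
  · refine le_iInf₂ fun G hG => ?_
    rw [ofReal_hardyNorm, hardy_ext fun n => (isSeriesOf_hardy_iff.1 hG n).trans (h n).symm]

end Hardy

/-! ### The mixed norm space -/

theorem ae_muAlpha_pos (α : ℝ) : ∀ᵐ σ ∂(muAlpha α), 0 < σ :=
  (withDensity_absolutelyContinuous _ _).ae_le (ae_restrict_mem measurableSet_Ioi)

theorem muAlpha_Ioc_ne_zero {α σ : ℝ} (hα : -1 < α) (hσ : 0 < σ) : muAlpha α (Set.Ioc 0 σ) ≠ 0 := by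
  rw [muAlpha, Ne, withDensity_apply_eq_zero' (by fun_prop)]
  intro h
  rw [Measure.restrict_apply' measurableSet_Ioi] at h
  have hsub : Set.Ioc 0 σ ⊆ ({x : ℝ | ENNReal.ofReal (2 ^ (α + 1) / Real.Gamma (α + 1) * x ^ α *
      Real.exp (-2 * x)) ≠ 0} ∩ Set.Ioc 0 σ) ∩ Set.Ioi 0 := fun x hx => by
    refine ⟨⟨?_, hx⟩, hx.1⟩
    have h1 : 0 < Real.Gamma (α + 1) := Real.Gamma_pos_of_pos (by linarith)
    have h2 : 0 < x ^ α := Real.rpow_pos_of_pos hx.1 α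
    have h3 : 0 < 2 ^ (α + 1) / Real.Gamma (α + 1) * x ^ α * Real.exp (-2 * x) := by positivity
    simpa using h3
  have := measure_mono_null hsub h
  simp [Real.volume_Ioc] at this
  linarith

section Mixed

variable {p q α : ℝ} {hp : 0 < p} {hq : 0 < q} {hα : -1 < α}

/-- `‖P_τ‖ ≥ ‖P_σ‖` for `0 < τ ≤ σ`, so the defining integral is at least `μ_α((0, σ]) ‖P_σ‖^q`, and
this mass is positive. -/
theorem exists_hardyPolyNorm_translatePoly_le (hp : 0 < p) (hq : 0 < q) (hα : -1 < α) {σ : ℝ}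
    (hσ : 0 < σ) : ∃ C : ℝ≥0∞, C ≠ ∞ ∧ ∀ P : DirPoly,
      hardyPolyNorm p (translatePoly σ P) ≤ C * mixedPolyNorm p q α P := by
  set m := muAlpha α (Set.Ioc 0 σ) with hm
  have hm0 : m ≠ 0 := muAlpha_Ioc_ne_zero hα hσ
  have hmt : m ≠ ∞ := ne_top_of_le_ne_top (muAlpha_univ_ne_top hα) (measure_mono (Set.subset_univ _))
  have h0 : m ^ (1 / q) ≠ 0 := by simp [ENNReal.rpow_eq_zero_iff, hm0, hmt]
  have ht : m ^ (1 / q) ≠ ∞ := ENNReal.rpow_ne_top_of_ne_zero hm0 hmt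
  refine ⟨(m ^ (1 / q))⁻¹, ENNReal.inv_ne_top.2 h0, fun P => ?_⟩
  rw [mul_comm, ← div_eq_mul_inv, ENNReal.le_div_iff_mul_le (Or.inl h0) (Or.inl ht)]
  have h1 : hardyPolyNorm p (translatePoly σ P) ^ q * m ≤
      ∫⁻ τ, hardyPolyNorm p (translatePoly τ P) ^ q ∂(muAlpha α) := by
    rw [← setLIntegral_const]
    refine le_trans (setLIntegral_mono' measurableSet_Ioc fun τ hτ => ?_)
      (setLIntegral_le_lintegral (Set.Ioc 0 σ) _)
    refine ENNReal.rpow_le_rpow ?_ hq.le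
    have e : translatePoly σ P = translatePoly (σ - τ) (translatePoly τ P) := by
      rw [translatePoly_translatePoly, add_sub_cancel]
    rw [e]
    exact hardyPolyNorm_translatePoly_le_self hp (sub_nonneg.2 hτ.2) _
  have h2 := ENNReal.rpow_le_rpow h1 (show 0 ≤ 1 / q by positivity)
  rwa [ENNReal.mul_rpow_of_nonneg _ _ (by positivity), ← ENNReal.rpow_mul,
    mul_one_div_cancel hq.ne', ENNReal.rpow_one] at h2

theorem mixedPolyNorm_le_hardyPolyNorm (hp : 0 < p) (hq : 0 < q) (P : DirPoly) :
    mixedPolyNorm p q α P ≤ (muAlpha α Set.univ) ^ (1 / q) * hardyPolyNorm p P := by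
  have h : ∫⁻ τ, hardyPolyNorm p (translatePoly τ P) ^ q ∂(muAlpha α) ≤
      muAlpha α Set.univ * hardyPolyNorm p P ^ q := by
    rw [mul_comm, ← lintegral_const]
    refine lintegral_mono_ae ?_
    filter_upwards [ae_muAlpha_pos α] with τ hτ
    exact ENNReal.rpow_le_rpow (hardyPolyNorm_translatePoly_le_self hp hτ.le _) hq.le
  refine (ENNReal.rpow_le_rpow h (by positivity)).trans (le_of_eq ?_)
  rw [ENNReal.mul_rpow_of_nonneg _ _ (by positivity), ← ENNReal.rpow_mul _ q,
    mul_one_div_cancel hq.ne', ENNReal.rpow_one]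

/-- The exponent `min (min 1 p) q` of the metric of `ℋ^{p,q}_α` is positive. -/
theorem mixedExponent_pos (hp : 0 < p) (hq : 0 < q) : 0 < min (min 1 p) q :=
  lt_min (lt_min one_pos hp) hq

/-- The (quasi-)norm of `ℋ^{p,q}_α` with values in `[0, ∞]`. -/
def mixedENorm (F : MixedSpace p q α hp hq hα) : ℝ≥0∞ := ‖F‖ₑ ^ (1 / min (min 1 p) q)

theorem ofReal_mixedNorm (F : MixedSpace p q α hp hq hα) :
    ENNReal.ofReal (mixedNorm F) = mixedENorm F := by
  have hr := mixedExponent_pos hp hq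
  rw [mixedNorm, mixedENorm, ← ENNReal.ofReal_rpow_of_nonneg (norm_nonneg _) (by positivity),
    ofReal_norm]

theorem mixedENorm_rpow (F : MixedSpace p q α hp hq hα) :
    mixedENorm F ^ min (min 1 p) q = ‖F‖ₑ := by
  rw [mixedENorm, ← ENNReal.rpow_mul, one_div_mul_cancel (mixedExponent_pos hp hq).ne',
    ENNReal.rpow_one]

theorem continuous_mixedENorm : Continuous (mixedENorm : MixedSpace p q α hp hq hα → ℝ≥0∞) :=
  ENNReal.continuous_rpow_const.comp continuous_enorm

theorem mixedENorm_toMixed (P : DirPoly) :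
    mixedENorm (toMixed p q α hp hq hα P) = mixedPolyNorm p q α P := by
  rw [← ofReal_mixedNorm, mixedNorm_toMixed, ENNReal.ofReal_toReal (mixedPolyNorm_ne_top hp hq hα P)]

theorem enorm_toMixed (P : DirPoly) :
    ‖toMixed p q α hp hq hα P‖ₑ = mixedPolyNorm p q α P ^ min (min 1 p) q := by
  rw [← mixedENorm_rpow, mixedENorm_toMixed]

theorem mixedPolyNorm_eq_enorm_rpow (P : MixedPoly p q α hp hq hα) :
    mixedPolyNorm p q α P = ‖P‖ₑ ^ (1 / min (min 1 p) q) := by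
  have h : ‖toMixed p q α hp hq hα P‖ₑ = ‖P‖ₑ := by
    rw [← ofReal_norm, ← ofReal_norm P]
    exact congrArg _ (UniformSpace.Completion.norm_coe P)
  exact (mixedENorm_toMixed (hp := hp) (hq := hq) (hα := hα) P).symm.trans
    (by rw [mixedENorm, h])

theorem denseRange_toMixed : DenseRange (toMixed p q α hp hq hα) :=
  UniformSpace.Completion.denseRange_coe (α := MixedPoly p q α hp hq hα)

theorem mixed_induction {prop : MixedSpace p q α hp hq hα → Prop} (F : MixedSpace p q α hp hq hα)
    (hc : IsClosed {F | prop F}) (h : ∀ P, prop (toMixed p q α hp hq hα P)) : prop F :=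
  UniformSpace.Completion.induction_on F hc h

theorem exists_seq_toMixed (F : MixedSpace p q α hp hq hα) :
    ∃ R : ℕ → DirPoly, Tendsto (fun k => toMixed p q α hp hq hα (R k)) atTop (𝓝 F) := by
  obtain ⟨u, hu, hlim⟩ := mem_closure_iff_seq_limit.1 (denseRange_toMixed F)
  choose R hR using hu
  exact ⟨R, by simpa only [hR] using hlim⟩

/-! ### Translations from the mixed norm space to the Hardy space -/

/-- The translation by `σ`, from the Dirichlet polynomials to `ℋ^p`. -/
def polyToHardy (hp : 0 < p) (hq : 0 < q) (hα : -1 < α) (σ : ℝ) :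
    MixedPoly p q α hp hq hα →+ HardySpace p hp where
  toFun P := toHardy p hp (translatePoly σ P)
  map_zero' := (congrArg (toHardy p hp) (translatePoly_zero_right σ)).trans
    (UniformSpace.Completion.coe_zero (α := HardyPoly p hp))
  map_add' P Q := (congrArg (toHardy p hp) (translatePoly_add σ P Q)).trans
    (UniformSpace.Completion.coe_add (α := HardyPoly p hp) _ _)

theorem exists_enorm_polyToHardy_le (hp : 0 < p) (hq : 0 < q) (hα : -1 < α) {σ : ℝ}
    (hσ : 0 < σ) : ∃ (C : ℝ≥0∞) (s : ℝ), C ≠ ∞ ∧ 0 < s ∧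
      ∀ P, ‖polyToHardy hp hq hα σ P‖ₑ ≤ C * ‖P‖ₑ ^ s := by
  have hr : 0 < min 1 p := lt_min one_pos hp
  have hr' := mixedExponent_pos hp hq
  obtain ⟨C, hC, h⟩ := exists_hardyPolyNorm_translatePoly_le hp hq hα hσ
  refine ⟨C ^ min 1 p, 1 / min (min 1 p) q * min 1 p, ENNReal.rpow_ne_top_of_nonneg hr.le hC,
    by positivity, fun P => ?_⟩
  rw [ENNReal.rpow_mul, ← mixedPolyNorm_eq_enorm_rpow, ← ENNReal.mul_rpow_of_nonneg _ _ hr.le]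
  exact (enorm_toHardy _).le.trans (ENNReal.rpow_le_rpow (h P) hr.le)

theorem continuous_polyToHardy {σ : ℝ} (hσ : 0 < σ) : Continuous (polyToHardy hp hq hα σ) := by
  obtain ⟨C, s, hC, hs, h⟩ := exists_enorm_polyToHardy_le hp hq hα hσ
  exact continuous_of_enorm_le _ hC hs h

/-- The translation `F ↦ F_σ` from `ℋ^{p,q}_α` to `ℋ^p`, for `σ > 0`. -/
def mixedTranslate {σ : ℝ} (hσ : 0 < σ) : MixedSpace p q α hp hq hα →+ HardySpace p hp :=
  (polyToHardy hp hq hα σ).extension (continuous_polyToHardy hσ)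

theorem continuous_mixedTranslate {σ : ℝ} (hσ : 0 < σ) :
    Continuous (mixedTranslate hσ : MixedSpace p q α hp hq hα →+ HardySpace p hp) :=
  AddMonoidHom.continuous_extension _ (continuous_polyToHardy hσ)

theorem mixedTranslate_toMixed {σ : ℝ} (hσ : 0 < σ) (P : DirPoly) :
    mixedTranslate hσ (toMixed p q α hp hq hα P) = toHardy p hp (translatePoly σ P) :=
  AddMonoidHom.extension_coe _ (continuous_polyToHardy hσ) _

theorem exists_enorm_mixedTranslate_le (hp : 0 < p) (hq : 0 < q) (hα : -1 < α) {σ : ℝ}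
    (hσ : 0 < σ) : ∃ (C : ℝ≥0∞) (s : ℝ), C ≠ ∞ ∧ 0 < s ∧
      ∀ F : MixedSpace p q α hp hq hα, ‖mixedTranslate hσ F‖ₑ ≤ C * ‖F‖ₑ ^ s := by
  obtain ⟨C, s, hC, hs, h⟩ := exists_enorm_polyToHardy_le hp hq hα hσ
  refine ⟨C, s, hC, hs, enorm_extension_le _ (continuous_mixedTranslate hσ) hC fun P => ?_⟩
  exact (congrArg _ (mixedTranslate_toMixed hσ P)).le.trans (h P)

/-- The `n`-th coefficient of an element of `ℋ^{p,q}_α`. -/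
def mixedCoeff (n : ℕ+) : MixedSpace p q α hp hq hα →+ ℂ :=
  -- Translation by `1` divides the `n`-th coefficient by `n`, and the factor `n` undoes this.
  (AddMonoidHom.mulLeft ((n : ℕ) : ℂ)).comp ((hardyCoeff n).comp (mixedTranslate one_pos))

theorem continuous_mixedCoeff (n : ℕ+) :
    Continuous (mixedCoeff n : MixedSpace p q α hp hq hα →+ ℂ) := by
  have h : Continuous fun F : MixedSpace p q α hp hq hα => hardyCoeff n (mixedTranslate one_pos F) :=
    (continuous_hardyCoeff n).comp (continuous_mixedTranslate one_pos)
  have h2 : Continuous fun F : MixedSpace p q α hp hq hα =>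
      ((n : ℕ) : ℂ) * hardyCoeff n (mixedTranslate one_pos F) := continuous_const.mul h
  exact h2

theorem mixedCoeff_toMixed (n : ℕ+) (P : DirPoly) :
    mixedCoeff n (toMixed p q α hp hq hα P) = P n := by
  have hn : ((n : ℕ) : ℂ) ≠ 0 := by exact_mod_cast n.ne_zero
  change ((n : ℕ) : ℂ) * hardyCoeff n (mixedTranslate one_pos (toMixed p q α hp hq hα P)) = P n
  rw [mixedTranslate_toMixed, hardyCoeff_toHardy, translatePoly_apply, Complex.ofReal_one,
    Complex.cpow_neg_one]
  field_simp

theorem hardyCoeff_mixedTranslate {σ : ℝ} (hσ : 0 < σ) (F : MixedSpace p q α hp hq hα) (n : ℕ+) :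
    hardyCoeff n (mixedTranslate hσ F) = mixedCoeff n F * ((n : ℕ) : ℂ) ^ (-(σ : ℂ)) :=
  mixed_induction (prop := fun F => hardyCoeff n (mixedTranslate hσ F) =
      mixedCoeff n F * ((n : ℕ) : ℂ) ^ (-(σ : ℂ))) F
    (isClosed_eq ((continuous_hardyCoeff n).comp (continuous_mixedTranslate hσ))
      ((continuous_mixedCoeff n).mul continuous_const)) fun P => by
    rw [mixedTranslate_toMixed, hardyCoeff_toHardy, mixedCoeff_toMixed, translatePoly_apply]

/-- The coefficient functionals of `ℋ^{p,q}_α`. -/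
theorem coeffSystem_mixed (hp : 0 < p) (hq : 0 < q) (hα : -1 < α) :
    CoeffSystem (toMixed p q α hp hq hα) fun n => mixedCoeff n where
  dense := denseRange_toMixed
  coeff := mixedCoeff_toMixed
  bound σ hσ := by
    have hr : 0 < min 1 p := lt_min one_pos hp
    -- Half of the distance from `σ` to `1/2` is spent on the translation into `ℋ^p`, the other half
    -- on absolute convergence there.
    have hτ : 0 < (σ - 1 / 2) / 2 := by linarith
    obtain ⟨K, hK, hb⟩ := exists_sum_hardyCoeff_le (p := p) (hp := hp)
      (show 1 / 2 < σ - (σ - 1 / 2) / 2 by linarith)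
    obtain ⟨C, s, hC, hs, h⟩ := exists_enorm_mixedTranslate_le hp hq hα hτ
    refine ⟨K * C ^ (1 / min 1 p), s * (1 / min 1 p),
      ENNReal.mul_ne_top hK (ENNReal.rpow_ne_top_of_nonneg (by positivity) hC), by positivity,
      fun F T => ?_⟩
    refine le_trans (le_of_eq (Finset.sum_congr rfl fun n _ => ?_))
      ((hb (mixedTranslate hτ F) T).trans ?_)
    · have hn : (0 : ℝ) < (n : ℕ) := by exact_mod_cast n.pos
      rw [hardyCoeff_mixedTranslate, CoeffSystem.enorm_term, mul_assoc,
        ← ENNReal.ofReal_mul (by positivity), Complex.ofReal_re, ← Real.rpow_add hn]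
      congr 3
      ring
    · rw [mul_assoc, ENNReal.rpow_mul, ← ENNReal.mul_rpow_of_nonneg _ _ (by positivity)]
      exact mul_le_mul_right (ENNReal.rpow_le_rpow (h F) (by positivity)) K

/-! ### The norm formula -/

/-- The function `σ ↦ ‖F_σ‖` on `(0, ∞)`, extended by zero. -/
def translateNorm (F : MixedSpace p q α hp hq hα) (σ : ℝ) : ℝ≥0∞ :=
  if hσ : 0 < σ then hardyENorm (mixedTranslate hσ F) else 0

theorem translateNorm_of_pos (F : MixedSpace p q α hp hq hα) {σ : ℝ} (hσ : 0 < σ) :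
    translateNorm F σ = hardyENorm (mixedTranslate hσ F) := dif_pos hσ

theorem continuous_translateNorm (σ : ℝ) :
    Continuous fun F : MixedSpace p q α hp hq hα => translateNorm F σ := by
  by_cases hσ : 0 < σ
  · simp only [translateNorm_of_pos _ hσ]
    exact continuous_hardyENorm.comp (continuous_mixedTranslate hσ)
  · simp only [translateNorm, dif_neg hσ]
    exact continuous_const

/-- It is the pointwise limit of the corresponding functions for polynomials tending to `F`. -/
theorem measurable_translateNorm (F : MixedSpace p q α hp hq hα) :
    Measurable (translateNorm F) := by
  obtain ⟨R, hR⟩ := exists_seq_toMixed F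
  refine measurable_of_tendsto_metrizable (f := fun k => translateNorm (toMixed p q α hp hq hα (R k)))
    (fun k => ?_) (tendsto_pi_nhds.2 fun σ => ((continuous_translateNorm σ).tendsto F).comp hR)
  have e : translateNorm (toMixed p q α hp hq hα (R k)) =
      (Set.Ioi 0).indicator fun σ => hardyPolyNorm p (translatePoly σ (R k)) := by
    funext σ
    by_cases hσ : 0 < σ
    · rw [translateNorm_of_pos _ hσ, mixedTranslate_toMixed, hardyENorm_toHardy,
        Set.indicator_of_mem (Set.mem_Ioi.2 hσ)]
    · rw [translateNorm, dif_neg hσ, Set.indicator_of_notMem (by simpa using hσ)]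
  rw [e]
  exact (measurable_hardyPolyNorm_translatePoly p (R k)).indicator measurableSet_Ioi

theorem translateNorm_add_rpow_le (F G : MixedSpace p q α hp hq hα) (σ : ℝ) :
    translateNorm (F + G) σ ^ min 1 p ≤
      translateNorm F σ ^ min 1 p + translateNorm G σ ^ min 1 p := by
  have hr : 0 < min 1 p := lt_min one_pos hp
  by_cases hσ : 0 < σ
  · simp only [translateNorm_of_pos _ hσ, hardyENorm_rpow, map_add]
    exact enorm_add_le _ _
  · simp [translateNorm, dif_neg hσ, hr]

theorem lintegral_translateNorm_toMixed (P : DirPoly) :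
    (∫⁻ σ, translateNorm (toMixed p q α hp hq hα P) σ ^ q ∂(muAlpha α)) ^ (1 / q) =
      mixedPolyNorm p q α P := by
  refine congrArg (· ^ (1 / q)) (lintegral_congr_ae ?_)
  filter_upwards [ae_muAlpha_pos α] with σ hσ
  rw [translateNorm_of_pos _ hσ, mixedTranslate_toMixed, hardyENorm_toHardy]

/-- Fatou's lemma along polynomials tending to `F`, since `F ↦ F_σ` is continuous for each `σ > 0`.
-/
theorem lintegral_translateNorm_le (F : MixedSpace p q α hp hq hα) :
    (∫⁻ σ, translateNorm F σ ^ q ∂(muAlpha α)) ^ (1 / q) ≤ mixedENorm F := by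
  obtain ⟨R, hR⟩ := exists_seq_toMixed F
  have h1 : ∫⁻ σ, translateNorm F σ ^ q ∂(muAlpha α) ≤ mixedENorm F ^ q := by
    calc _ = ∫⁻ σ, liminf (fun k => translateNorm (toMixed p q α hp hq hα (R k)) σ ^ q) atTop
          ∂(muAlpha α) := lintegral_congr fun σ =>
            ((ENNReal.continuous_rpow_const.comp (continuous_translateNorm σ)).tendsto F |>.comp
              hR).liminf_eq.symm
      _ ≤ liminf (fun k => ∫⁻ σ, translateNorm (toMixed p q α hp hq hα (R k)) σ ^ q ∂(muAlpha α))
          atTop := lintegral_liminf_le fun k => (measurable_translateNorm _).pow_const _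
      _ = liminf (fun k => mixedENorm (toMixed p q α hp hq hα (R k)) ^ q) atTop := by
          refine congrArg (fun u => liminf u atTop) (funext fun k => ?_)
          rw [mixedENorm_toMixed, ← lintegral_translateNorm_toMixed (hp := hp) (hq := hq) (hα := hα),
            ← ENNReal.rpow_mul, one_div_mul_cancel hq.ne', ENNReal.rpow_one]
      _ = mixedENorm F ^ q :=
          ((ENNReal.continuous_rpow_const.comp continuous_mixedENorm).tendsto F |>.comp hR).liminf_eq
  refine (ENNReal.rpow_le_rpow h1 (by positivity)).trans (le_of_eq ?_)
  rw [← ENNReal.rpow_mul, mul_one_div_cancel hq.ne', ENNReal.rpow_one]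

/-- The norm of `ℋ^{p,q}_α` is the mixed norm of the translates. -/
theorem lintegral_translateNorm (F : MixedSpace p q α hp hq hα) :
    (∫⁻ σ, translateNorm F σ ^ q ∂(muAlpha α)) ^ (1 / q) = mixedENorm F := by
  have hr := mixedExponent_pos hp hq
  refine le_antisymm (lintegral_translateNorm_le F) ?_
  obtain ⟨R, hR⟩ := exists_seq_toMixed F
  set I := ((∫⁻ σ, translateNorm F σ ^ q ∂(muAlpha α)) ^ (1 / q)) ^ min (min 1 p) q with hI
  -- Subadditivity for `P = F + (P - F)`: the formula is known for `P`, and the inequality already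
  -- proved controls the integral of `P - F`. Letting `P → F` gives the claim.
  have h1 : ∀ P : DirPoly, ‖toMixed p q α hp hq hα P‖ₑ ≤ I + ‖toMixed p q α hp hq hα P - F‖ₑ :=
    fun P => by
      have h2 := Lq_rpow_min_le (muAlpha α) (lt_min one_pos hp) hq (measurable_translateNorm F)
        (measurable_translateNorm (toMixed p q α hp hq hα P - F))
        (translateNorm_add_rpow_le F (toMixed p q α hp hq hα P - F))
      rw [add_sub_cancel, lintegral_translateNorm_toMixed, ← enorm_toMixed] at h2
      refine h2.trans (add_le_add le_rfl ?_)
      rw [← mixedENorm_rpow (toMixed p q α hp hq hα P - F)]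
      exact ENNReal.rpow_le_rpow (lintegral_translateNorm_le _) hr.le
  have h3 : ‖F‖ₑ ≤ I := by
    refine le_of_tendsto_of_tendsto' ((continuous_enorm.tendsto F).comp hR)
      (g := fun k => I + ‖toMixed p q α hp hq hα (R k) - F‖ₑ) ?_ fun k => h1 (R k)
    simpa using tendsto_const_nhds.add (tendsto_iff_enorm_sub_tendsto_zero.1 hR)
  rw [mixedENorm]
  refine (ENNReal.rpow_le_rpow h3 (by positivity)).trans (le_of_eq ?_)
  rw [hI, ← ENNReal.rpow_mul _ (min (min 1 p) q), mul_one_div_cancel hr.ne', ENNReal.rpow_one]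

/-! ### Uniqueness in the mixed norm space -/

/-- The difference has zero translates, by uniqueness in `ℋ^p`, and hence zero norm by the norm
formula. -/
theorem mixed_ext {F G : MixedSpace p q α hp hq hα} (h : ∀ n, mixedCoeff n F = mixedCoeff n G) :
    F = G := by
  have hr := mixedExponent_pos hp hq
  rw [← sub_eq_zero, ← enorm_eq_zero, ← mixedENorm_rpow, ← lintegral_translateNorm]
  have h0 : ∀ σ, translateNorm (F - G) σ = 0 := fun σ => by
    by_cases hσ : 0 < σ
    · have h1 : mixedTranslate hσ (F - G) = 0 := eq_zero_of_hardyCoeff_eq_zero fun n => by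
        rw [hardyCoeff_mixedTranslate, map_sub, h, sub_self, zero_mul]
      have hr : 0 < min 1 p := lt_min one_pos hp
      rw [translateNorm_of_pos _ hσ, h1, hardyENorm, enorm_zero,
        ENNReal.zero_rpow_of_pos (by positivity)]
    · rw [translateNorm, dif_neg hσ]
  simp [h0, hq, hr]

theorem isSeriesOf_mixed_iff {F : MixedSpace p q α hp hq hα} {a : ℕ+ → ℂ} :
    IsSeriesOf (toMixed p q α hp hq hα) F a ↔ ∀ n, mixedCoeff n F = a n := by
  constructor
  · intro h n
    rw [(coeffSystem_mixed hp hq hα).eq_coeff_of_isSeriesOf h]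
  · intro h
    rw [← funext h]
    exact (coeffSystem_mixed hp hq hα).isSeriesOf F

theorem hardyCoeff_mixedTranslate_eq_translate {F : MixedSpace p q α hp hq hα} {σ : ℝ}
    (hσ : 0 < σ) (n : ℕ+) :
    hardyCoeff n (mixedTranslate hσ F) = translate σ (fun n => mixedCoeff n F) n :=
  hardyCoeff_mixedTranslate hσ F n

theorem mixedENorm_eq (F : MixedSpace p q α hp hq hα) : mixedENorm F =
    (∫⁻ σ, seriesHardyNorm p hp (translate σ fun n => mixedCoeff n F) ^ q ∂(muAlpha α)) ^ (1 / q) := by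
  rw [← lintegral_translateNorm]
  refine congrArg (· ^ (1 / q)) (lintegral_congr_ae ?_)
  filter_upwards [ae_muAlpha_pos α] with σ hσ
  rw [translateNorm_of_pos _ hσ, seriesHardyNorm_eq (hardyCoeff_mixedTranslate_eq_translate hσ)]

/-! ### The Hardy space in the mixed norm space -/

/-- The identity, from the Dirichlet polynomials with the norm of `ℋ^p` to `ℋ^{p,q}_α`. -/
def polyToMixed (hp : 0 < p) (hq : 0 < q) (hα : -1 < α) :
    HardyPoly p hp →+ MixedSpace p q α hp hq hα where
  toFun P := toMixed p q α hp hq hα P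
  map_zero' := UniformSpace.Completion.coe_zero (α := MixedPoly p q α hp hq hα)
  map_add' P Q := UniformSpace.Completion.coe_add (α := MixedPoly p q α hp hq hα) P Q

theorem continuous_polyToMixed : Continuous (polyToMixed hp hq hα) := by
  have hr : 0 < min 1 p := lt_min one_pos hp
  have hr' := mixedExponent_pos hp hq
  refine continuous_of_enorm_le _ (C := ((muAlpha α Set.univ) ^ (1 / q)) ^ min (min 1 p) q)
    (ENNReal.rpow_ne_top_of_nonneg hr'.le (ENNReal.rpow_ne_top_of_nonneg (by positivity)
      (muAlpha_univ_ne_top hα))) (s := 1 / min 1 p * min (min 1 p) q) (by positivity) fun P => ?_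
  rw [ENNReal.rpow_mul, ← hardyPolyNorm_eq_enorm_rpow, ← ENNReal.mul_rpow_of_nonneg _ _ hr'.le]
  exact (enorm_toMixed _).le.trans
    (ENNReal.rpow_le_rpow (mixedPolyNorm_le_hardyPolyNorm hp hq P) hr'.le)

/-- The inclusion of `ℋ^p` in `ℋ^{p,q}_α`. -/
def hardyToMixed (hp : 0 < p) (hq : 0 < q) (hα : -1 < α) :
    HardySpace p hp →+ MixedSpace p q α hp hq hα :=
  (polyToMixed hp hq hα).extension continuous_polyToMixed

theorem mixedCoeff_hardyToMixed (G : HardySpace p hp) (n : ℕ+) :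
    mixedCoeff n (hardyToMixed hp hq hα G) = hardyCoeff n G :=
  hardy_induction (prop := fun G => mixedCoeff n (hardyToMixed hp hq hα G) = hardyCoeff n G) G
    (isClosed_eq ((continuous_mixedCoeff n).comp
      (AddMonoidHom.continuous_extension _ continuous_polyToMixed)) (continuous_hardyCoeff n))
    fun P => by
      have h : hardyToMixed hp hq hα (toHardy p hp P) = toMixed p q α hp hq hα P :=
        AddMonoidHom.extension_coe _ continuous_polyToMixed _
      rw [h, mixedCoeff_toMixed, hardyCoeff_toHardy]

/-! ### Sufficiency of the integral condition -/

/-- The translates `f_δ` approximate `f`: they belong to `ℋ^p`, hence to the mixed space, and form a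
Cauchy sequence along `δ = 1/(k+1)`. -/
theorem memMixed_of_lintegral_lt_top (hp : 0 < p) (hq : 0 < q) (hα : -1 < α) {a : ℕ+ → ℂ}
    (ha : ∀ σ : ℝ, 0 < σ → MemHardy p hp (translate σ a))
    (hI : ∫⁻ σ, seriesHardyNorm p hp (translate σ a) ^ q ∂(muAlpha α) < ∞) :
    MemMixed p q α hp hq hα a := by
  have hr : 0 < min 1 p := lt_min one_pos hp
  have hr' := mixedExponent_pos hp hq
  choose G hG using ha
  have hGc : ∀ σ (hσ : 0 < σ) n, hardyCoeff n (G σ hσ) = a n * ((n : ℕ) : ℂ) ^ (-(σ : ℂ)) :=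
    fun σ hσ => isSeriesOf_hardy_iff.1 (hG σ hσ)
  set δ : ℕ → ℝ≥0 := fun k => 1 / ((k : ℝ≥0) + 1) with hδ
  have hδ0 : ∀ k, (0 : ℝ) < δ k := fun k => by
    have : 0 < δ k := by positivity
    exact_mod_cast this
  have hδt : Tendsto δ atTop (𝓝 0) := tendsto_one_div_add_atTop_nhds_zero_nat
  set F : ℕ → MixedSpace p q α hp hq hα := fun k => hardyToMixed hp hq hα (G (δ k) (hδ0 k)) with hF
  -- Translations commute: `(f_δ)_σ = (f_σ)_δ`, by comparison of coefficients. The right-hand side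
  -- is a contraction applied to the fixed element `f_σ`.
  have hFσ : ∀ k σ (hσ : 0 < σ), mixedTranslate hσ (F k) = hardyTranslate (δ k) (G σ hσ) :=
    fun k σ hσ => hardy_ext fun n => by
      rw [hardyCoeff_mixedTranslate, hF, mixedCoeff_hardyToMixed, hardyCoeff_hardyTranslate, hGc, hGc]
      ring
  have hdom : Tendsto (fun kl : ℕ × ℕ => ∫⁻ σ, translateNorm (F kl.1 - F kl.2) σ ^ q ∂(muAlpha α))
      atTop (𝓝 (∫⁻ _, 0 ∂(muAlpha α))) := by
    -- Two translates of `f_σ`, each of norm at most `‖f_σ‖`, differ by at most `2^{1/min(1,p)}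
    -- ‖f_σ‖`, because the `min(1,p)`-th power of the norm is subadditive.
    refine tendsto_lintegral_filter_of_dominated_convergence
      (fun σ => ((2 : ℝ≥0∞) ^ (1 / min 1 p)) ^ q * seriesHardyNorm p hp (translate σ a) ^ q)
      (Eventually.of_forall fun kl => (measurable_translateNorm _).pow_const _)
      (Eventually.of_forall fun kl => ?_) ?_ ?_
    · filter_upwards [ae_muAlpha_pos α] with σ hσ
      rw [← ENNReal.mul_rpow_of_nonneg _ _ hq.le]
      refine ENNReal.rpow_le_rpow ?_ hq.le
      rw [translateNorm_of_pos _ hσ, seriesHardyNorm_eq (a := translate σ a) (hGc σ hσ), map_sub, hFσ, hFσ, hardyENorm,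
        hardyENorm, ← ENNReal.mul_rpow_of_nonneg _ _ (by positivity)]
      refine ENNReal.rpow_le_rpow (enorm_sub_le.trans ?_) (by positivity)
      rw [two_mul]
      exact add_le_add (enorm_hardyTranslate_le _ _) (enorm_hardyTranslate_le _ _)
    · rw [lintegral_const_mul' _ _ (by finiteness)]
      exact ENNReal.mul_ne_top (by finiteness) hI.ne
    · filter_upwards [ae_muAlpha_pos α] with σ hσ
      have h1 : Tendsto (fun k => hardyTranslate (δ k) (G σ hσ)) atTop (𝓝 (G σ hσ)) :=
        (tendsto_hardyTranslate _).comp hδt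
      have h2 : Tendsto (fun kl : ℕ × ℕ => hardyTranslate (δ kl.1) (G σ hσ) -
          hardyTranslate (δ kl.2) (G σ hσ)) atTop (𝓝 (G σ hσ - G σ hσ)) := by
        rw [← prod_atTop_atTop_eq]
        exact (h1.comp tendsto_fst).sub (h1.comp tendsto_snd)
      have h3 := (ENNReal.continuous_rpow_const (y := q)).tendsto _ |>.comp
        ((continuous_hardyENorm.tendsto _).comp h2)
      rw [sub_self, hardyENorm, enorm_zero, ENNReal.zero_rpow_of_pos (by positivity),
        ENNReal.zero_rpow_of_pos hq] at h3
      refine h3.congr fun kl => ?_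
      simp only [Function.comp, translateNorm_of_pos _ hσ, map_sub, hFσ]
  have hcau : CauchySeq F := by
    rw [cauchySeq_iff_tendsto_dist_atTop_0]
    simp only [dist_eq_norm]
    rw [← tendsto_zero_iff_norm_tendsto_zero, tendsto_zero_iff_enorm_tendsto_zero]
    rw [lintegral_zero] at hdom
    have h4 := (ENNReal.continuous_rpow_const (y := min (min 1 p) q)).tendsto _ |>.comp
      ((ENNReal.continuous_rpow_const (y := 1 / q)).tendsto _ |>.comp hdom)
    rw [ENNReal.zero_rpow_of_pos (by positivity), ENNReal.zero_rpow_of_pos hr'] at h4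
    refine h4.congr fun kl => ?_
    simp only [Function.comp]
    rw [lintegral_translateNorm, mixedENorm_rpow]
  obtain ⟨F₀, hF₀⟩ := cauchySeq_tendsto_of_complete hcau
  refine ⟨F₀, isSeriesOf_mixed_iff.2 fun n => ?_⟩
  -- The coefficients `a_n n^{-δ}` of `f_δ` tend both to those of the limit and to `a_n`.
  have h5 : Tendsto (fun k => mixedCoeff n (F k)) atTop (𝓝 (mixedCoeff n F₀)) :=
    ((continuous_mixedCoeff n).tendsto F₀).comp hF₀
  refine tendsto_nhds_unique h5 ?_
  have h6 : Continuous fun σ : ℝ≥0 => a n * ((n : ℕ) : ℂ) ^ (-((σ : ℝ) : ℂ)) :=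
    continuous_const.mul (Continuous.const_cpow (by fun_prop)
      (Or.inl (by exact_mod_cast n.ne_zero)))
  have h7 := (h6.tendsto 0).comp hδt
  simp only [NNReal.coe_zero, Complex.ofReal_zero, neg_zero, Complex.cpow_zero, mul_one] at h7
  refine h7.congr fun k => ?_
  simp only [Function.comp, hF, mixedCoeff_hardyToMixed, hGc]

end Mixed

end DirichletHardy

end

open DirichletHardy in
theorem theorem2p3 (p q α : ℝ) (hp : 0 < p) (hq : 0 < q) (hα : -1 < α) :
    -- every element of the mixed norm space is a Dirichlet series
    (∀ F : MixedSpace p q α hp hq hα, ∃ a : ℕ+ → ℂ,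
      IsSeriesOf (toMixed p q α hp hq hα) F a ∧
      -- the series determines the element and conversely
      (∀ b : ℕ+ → ℂ, IsSeriesOf (toMixed p q α hp hq hα) F b → b = a) ∧
      (∀ F' : MixedSpace p q α hp hq hα, IsSeriesOf (toMixed p q α hp hq hα) F' a → F' = F) ∧
      -- uniform convergence on the half planes to the right of `1/2`
      (∀ ε : ℝ, 0 < ε → ∃ f : ℂ → ℂ,
        TendstoUniformlyOn (fun N s => partialSum a N s) f atTop (halfPlane (1 / 2 + ε))) ∧
      -- the translates are in the Hardy space, and the norm formula
      (∀ σ : ℝ, 0 < σ → MemHardy p hp (translate σ a)) ∧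
      ENNReal.ofReal (mixedNorm F) =
        (∫⁻ σ, seriesHardyNorm p hp (translate σ a) ^ q ∂(muAlpha α)) ^ (1 / q)) ∧
    -- conversely, the integral condition is sufficient
    (∀ a : ℕ+ → ℂ, InD a → (∀ σ : ℝ, 0 < σ → MemHardy p hp (translate σ a)) →
      (∫⁻ σ, seriesHardyNorm p hp (translate σ a) ^ q ∂(muAlpha α)) < ⊤ →
      MemMixed p q α hp hq hα a) := by
  have hS := coeffSystem_mixed hp hq hα
  refine ⟨fun F => ⟨fun n => mixedCoeff n F, hS.isSeriesOf F,
    fun b hb => hS.eq_coeff_of_isSeriesOf hb, fun F' hF' => ?_, fun ε hε => ?_, fun σ hσ => ?_, ?_⟩,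
    fun a _ ha hI => memMixed_of_lintegral_lt_top hp hq hα ha hI⟩
  · exact mixed_ext (isSeriesOf_mixed_iff.1 hF')
  · exact ⟨_, hS.tendstoUniformlyOn F hε⟩
  · exact ⟨mixedTranslate hσ F,
      isSeriesOf_hardy_iff.2 (hardyCoeff_mixedTranslate_eq_translate hσ)⟩
  · rw [ofReal_mixedNorm, mixedENorm_eq]
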